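/- Let $d\in\{2,3\}$, let $\alpha\in(0,1)$ if $d=3$ and $\alpha\in(\frac12,\frac34)$ if $d=2$, and let $\Omega\subset\mathbb{R}^d$ be a bounded Lipschitz domain and $s\in\mathbb{R}$. Let $$\phi_\alpha(\mathbf{x})=\frac{\Gamma(\frac d2-\alpha)}{4^{\alpha}\,\pi^{d/2}\,\Gamma(\alpha)}\,|\mathbf{x}|^{2\alpha-d}$$ be the fundamental solution of $(-\Delta)^\alpha$ on $\mathbb{R}^d$, and let $R_\alpha(u)=\phi_\alpha * u$ be the Riesz potential; that is, $R_\alpha(u)(\mathbf{x})=\int_{\mathbb{R}^d}\phi_\alpha(\mathbf{x}-\mathbf{y})u(\mathbf{y})\,\mathrm{d}\mathbf{y}$ for a function $u\in L^2(\mathbb{R}^d)$ that vanishes outside a bounded set, and $\langle R_\alpha(u),\psi\rangle=\langle u,\phi_\alpha*\psi\rangle$, $\psi\in C_0^\infty(\mathbb{R}^d)$, for a compactly supported distribution $u$. For real $r$ let $H^r(\mathbb{R}^d)$ be the space of the tempered distributions $u$ with $\|u\|_r^2=\int(1+|\xi|^2)^{r}|\mathcal{F}u(\xi)|^2\,\mathrm{d}\xi<\infty$,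 let $H^r(\Omega)$ be the space of the restrictions to $\Omega$ of elements of $H^r(\mathbb{R}^d)$, with the quotient norm (the infimum of the norms of all extensions), and let $\widetilde H^r(\Omega)$ be the space of those $u\in H^r(\mathbb{R}^d)$ whose support lies in $\overline\Omega$, with the norm of $H^r(\mathbb{R}^d)$. (For $r<0$, $\widetilde H^{r}(\Omega)$ is the dual space of $H^{-r}(\Omega)$.) Then: 1. $R_\alpha$, followed by restriction to $\Omega$, is a continuous linear map from $\widetilde H^{s-2\alpha}(\Omega)$ to $H^s(\Omega)$, i.e. $\|R_\alpha(u)\|_{H^s(\Omega)}\le C\|u\|_{s-2\alpha}$ for all $u\in\widetilde H^{s-2\alpha}(\Omega)$, with a constant $C$ that does not depend on $u$. 2. If $0\le s-2\alpha<\frac12$, then $R_\alpha$ is also a continuous linear map from $H^{s-2\alpha}(\Omega)$ to $H^s(\Omega)$, where the functions $u\in H^{s-2\alpha}(\Omega)\subset L^2(\Omega)$ are extended by zero outside $\Omega$: $\|R_\alpha(u)\|_{H^s(\Omega)}\le C\|u\|_{H^{s-2\alpha}(\Omega)}$, $R_\alpha(u)(\mathbf{x})=\int_\Omega\phi_\alpha(\mathbf{x}-\mathbf{y})u(\mathbf{y})\,\mathrm{d}\mathbf{y}$.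 -/

import Mathlib

open MeasureTheory Filter Topology Set
open scoped SchwartzMap ContDiff

noncomputable section

namespace RieszPotential

/-- The Euclidean space `ℝ^d`. -/
abbrev E (d : ℕ) : Type := EuclideanSpace ℝ (Fin d)

/-! ### The Sobolev spaces on `ℝ^d` -/

/-- The tempered distributions on `ℝ^d` that belong to the (`L²`-based) Sobolev space `H^s(ℝ^d)`,
as a subspace of the space of all tempered distributions. -/
def sobolevSubmodule (d : ℕ) (s : ℝ) : Submodule ℂ 𝓢'(E d, ℂ) where
  carrier := {f | TemperedDistribution.MemSobolev s 2 f}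
  add_mem' hf hg := hf.add hg
  zero_mem' := TemperedDistribution.memSobolev_fun_zero (E d) ℂ s 2
  smul_mem' c _ hf := hf.smul c

/-- The Sobolev space `H^s(ℝ^d)`. This is a type synonym, because its norm is not the topology
inherited from the tempered distributions. -/
def SobolevSpace (d : ℕ) (s : ℝ) : Type := sobolevSubmodule d s

instance (d : ℕ) (s : ℝ) : AddCommGroup (SobolevSpace d s) :=
  inferInstanceAs (AddCommGroup (sobolevSubmodule d s))

instance (d : ℕ) (s : ℝ) : Module ℂ (SobolevSpace d s) :=
  inferInstanceAs (Module ℂ (sobolevSubmodule d s))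

namespace SobolevSpace

variable {d : ℕ} {s : ℝ}

/-- An element of `H^s(ℝ^d)` as a tempered distribution. -/
def toDistribution : SobolevSpace d s →ₗ[ℂ] 𝓢'(E d, ℂ) := (sobolevSubmodule d s).subtype

theorem toDistribution_injective :
    Function.Injective (toDistribution : SobolevSpace d s →ₗ[ℂ] 𝓢'(E d, ℂ)) :=
  Subtype.val_injective

theorem lp_toDistribution_injective :
    Function.Injective (Lp.toTemperedDistributionCLM ℂ (volume : Measure (E d)) 2) :=
  LinearMap.ker_eq_bot.mp Lp.ker_toTemperedDistributionCLM_eq_bot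

theorem exists_bessel (f : SobolevSpace d s) : ∃ g : Lp ℂ 2 (volume : Measure (E d)),
    TemperedDistribution.besselPotential (E d) ℂ s (toDistribution f) =
      Lp.toTemperedDistributionCLM ℂ volume 2 g := by
  obtain ⟨g, hg⟩ := f.2
  exact ⟨g, hg⟩

/-- The `L²` function with Fourier transform `(1 + |ξ|²)^{s/2} 𝓕 f(ξ)`, for `f` in `H^s(ℝ^d)`. -/
def bessel : SobolevSpace d s →ₗ[ℂ] Lp ℂ 2 (volume : Measure (E d)) where
  toFun f := (exists_bessel f).choose
  map_add' f g := by
    apply lp_toDistribution_injective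
    refine (exists_bessel (f + g)).choose_spec.symm.trans ?_
    rw [map_add, map_add, map_add]
    exact congrArg₂ (· + ·) (exists_bessel f).choose_spec (exists_bessel g).choose_spec
  map_smul' c f := by
    apply lp_toDistribution_injective
    refine (exists_bessel (c • f)).choose_spec.symm.trans ?_
    rw [map_smul, map_smul, map_smul]
    exact congrArg (c • ·) (exists_bessel f).choose_spec

theorem bessel_spec (f : SobolevSpace d s) :
    TemperedDistribution.besselPotential (E d) ℂ s (toDistribution f) =
      Lp.toTemperedDistributionCLM ℂ volume 2 (bessel f) :=
  (exists_bessel f).choose_spec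

theorem toDistribution_eq (f : SobolevSpace d s) :
    toDistribution f = TemperedDistribution.besselPotential (E d) ℂ (-s)
      (Lp.toTemperedDistributionCLM ℂ volume 2 (bessel f)) := by
  rw [← bessel_spec]
  simp

theorem bessel_injective :
    Function.Injective (bessel : SobolevSpace d s →ₗ[ℂ] Lp ℂ 2 (volume : Measure (E d))) := by
  intro f g h
  apply toDistribution_injective
  rw [toDistribution_eq, toDistribution_eq, h]

/-- The norm of `f` in `H^s(ℝ^d)` is the `L²` norm of `(1 + |ξ|²)^{s/2} 𝓕 f(ξ)`, which equals (by
Plancherel) the `L²` norm of `bessel f`. -/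
instance : NormedAddCommGroup (SobolevSpace d s) :=
  NormedAddCommGroup.induced _ _ bessel bessel_injective

instance : NormedSpace ℂ (SobolevSpace d s) :=
  NormedSpace.induced ℂ _ _ bessel

theorem continuous_bessel :
    Continuous (bessel : SobolevSpace d s →ₗ[ℂ] Lp ℂ 2 (volume : Measure (E d))) :=
  continuous_induced_dom

theorem continuous_toDistribution_apply (ψ : 𝓢(E d, ℂ)) :
    Continuous fun f : SobolevSpace d s ↦ toDistribution f ψ := by
  have h : Continuous fun f : SobolevSpace d s ↦
      TemperedDistribution.besselPotential (E d) ℂ (-s)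
        (Lp.toTemperedDistributionCLM ℂ volume 2 (bessel f)) :=
    (TemperedDistribution.besselPotential (E d) ℂ (-s)).continuous.comp
      ((Lp.toTemperedDistributionCLM ℂ volume 2).continuous.comp continuous_bessel)
  simp_rw [← toDistribution_eq] at h
  exact (PointwiseConvergenceCLM.evalCLM (RingHom.id ℂ) ℂ ψ).continuous.comp h

end SobolevSpace

/-! ### Sobolev spaces for a set `Ω ⊆ ℝ^d` -/

/-- The elements of `H^s(ℝ^d)` that vanish on the (open) set `Ω` as distributions. -/
def vanishingOn (d : ℕ) (s : ℝ) (Ω : Set (E d)) : Submodule ℂ (SobolevSpace d s) where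
  carrier := {f | Distribution.IsVanishingOn f.toDistribution Ω}
  add_mem' {f g} hf hg ψ hψ := by
    change (SobolevSpace.toDistribution (f + g)) ψ = 0
    rw [map_add]
    change f.toDistribution ψ + g.toDistribution ψ = 0
    rw [hf ψ hψ, hg ψ hψ, add_zero]
  zero_mem' ψ _ := by
    change (SobolevSpace.toDistribution (0 : SobolevSpace d s)) ψ = 0
    rw [map_zero]
    rfl
  smul_mem' c f hf ψ hψ := by
    change (SobolevSpace.toDistribution (c • f)) ψ = 0
    rw [map_smul]
    change c • f.toDistribution ψ = 0
    rw [hf ψ hψ, smul_zero]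

instance isClosed_vanishingOn (d : ℕ) (s : ℝ) (Ω : Set (E d)) :
    IsClosed (vanishingOn d s Ω : Set (SobolevSpace d s)) := by
  have : (vanishingOn d s Ω : Set (SobolevSpace d s)) =
      ⋂ (ψ : 𝓢(E d, ℂ)) (_ : tsupport ψ ⊆ Ω), {f | f.toDistribution ψ = 0} := by
    ext f
    simp only [mem_iInter]
    rfl
  rw [this]
  exact isClosed_iInter fun ψ ↦ isClosed_iInter fun _ ↦
    isClosed_eq (SobolevSpace.continuous_toDistribution_apply ψ) continuous_const

/-- The Sobolev space `H^s(Ω)` of all restrictions to `Ω` of elements of `H^s(ℝ^d)`. Two elements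
have the same restriction if their difference vanishes on `Ω`, and the norm of a restriction is the
infimum of the norms of its extensions in `H^s(ℝ^d)`: this is the quotient norm. -/
abbrev SobolevOn (d : ℕ) (s : ℝ) (Ω : Set (E d)) : Type :=
  SobolevSpace d s ⧸ vanishingOn d s Ω

/-- The restriction to `Ω` of an element of `H^s(ℝ^d)`. -/
def restrict {d : ℕ} {s : ℝ} (Ω : Set (E d)) : SobolevSpace d s →ₗ[ℂ] SobolevOn d s Ω :=
  (vanishingOn d s Ω).mkQ

/-- The action of an element of `H^s(Ω)`, which is a distribution on `Ω`, on a test function `ψ`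
with support in `Ω`. -/
def SobolevOn.pairing {d : ℕ} {s : ℝ} {Ω : Set (E d)} (ψ : 𝓢(E d, ℂ)) (hψ : tsupport ψ ⊆ Ω) :
    SobolevOn d s Ω →ₗ[ℂ] ℂ :=
  (vanishingOn d s Ω).liftQ
    { toFun := fun f ↦ f.toDistribution ψ
      map_add' := fun f g ↦ by rw [map_add]; rfl
      map_smul' := fun c f ↦ by rw [map_smul]; rfl }
    (fun _ hf ↦ hf ψ hψ)

/-- The space `H̃^s(Ω)` of all distributions in `H^s(ℝ^d)` with support in the closure of `Ω`, with
the norm of `H^s(ℝ^d)`. -/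
abbrev SobolevSupported (d : ℕ) (s : ℝ) (Ω : Set (E d)) : Type :=
  vanishingOn d s (closure Ω)ᶜ

/-! ### Lipschitz domains -/

/-- A bounded open set `Ω` such that, near every boundary point, `Ω` is the set of the points that
lie strictly below the graph of a Lipschitz function, in a suitable orthonormal coordinate
system. Here `ν` is the direction of the last coordinate axis, `⟪ν, x⟫` is the last coordinate of
`x`, and `x - ⟪ν, x⟫ ν` is the projection of `x` to the hyperplane of the other coordinates. -/
structure IsBoundedLipschitzDomain {d : ℕ} (Ω : Set (E d)) : Prop where
  isOpen : IsOpen Ω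
  isBounded : Bornology.IsBounded Ω
  locally_graph : ∀ p ∈ frontier Ω, ∃ (ν : E d) (K : NNReal) (ζ : E d → ℝ),
    ‖ν‖ = 1 ∧ LipschitzWith K ζ ∧
      ∀ᶠ x in 𝓝 p, (x ∈ Ω ↔ inner ℝ ν x < ζ (x - (inner ℝ ν x : ℝ) • ν))

/-! ### The Riesz potential -/

/-- The fundamental solution `φ_α(x) = Γ(d/2 - α) / (4^α π^{d/2} Γ(α)) |x|^{2α-d}` of the
fractional Laplacian `(-Δ)^α` on `ℝ^d`, where `0 < α < d/2`. -/
def kernel (d : ℕ) (α : ℝ) (x : E d) : ℝ :=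
  Real.Gamma (d / 2 - α) / (4 ^ α * Real.pi ^ ((d : ℝ) / 2) * Real.Gamma α) *
    ‖x‖ ^ (2 * α - d)

/-- The Riesz potential `R_α(u) = φ_α * u` of a function `u` on `ℝ^d`. -/
def rieszPotential {d : ℕ} (α : ℝ) (u : E d → ℂ) (x : E d) : ℂ :=
  ∫ y, (kernel d α (x - y) : ℂ) * u y

/-- `v` is, as a distribution on `Ω`, the function `F`. -/
def IsGivenBy {d : ℕ} {s : ℝ} {Ω : Set (E d)} (v : SobolevOn d s Ω) (F : E d → ℂ) : Prop :=
  LocallyIntegrable F volume ∧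
    ∀ (ψ : 𝓢(E d, ℂ)) (hψ : tsupport ψ ⊆ Ω), SobolevOn.pairing ψ hψ v = ∫ x, ψ x * F x

/-- `v` is the restriction to `Ω` of the Riesz potential `φ_α * u` of a distribution `u` with
support in the (compact) closure of `Ω`. The function `φ_α` is even, so that the convolution is
given by `⟨φ_α * u, ψ⟩ = ⟨u, φ_α * ψ⟩`. The function `φ_α * ψ` is smooth, and since `u` has compact
support, the right hand side means `⟨u, g⟩` for any Schwartz function `g` which coincides with
`φ_α * ψ` near the closure of `Ω`. Such a `g` exists by `exists_schwartz_eq_rieszPotential`. -/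
def IsRieszPotential {d : ℕ} (α : ℝ) {s t : ℝ} {Ω : Set (E d)} (u : SobolevSpace d t)
    (v : SobolevOn d s Ω) : Prop :=
  ∀ (ψ : 𝓢(E d, ℂ)) (hψ : tsupport ψ ⊆ Ω) (g : 𝓢(E d, ℂ)),
    (∀ᶠ x in 𝓝ˢ (closure Ω), g x = rieszPotential α ψ x) →
      SobolevOn.pairing ψ hψ v = u.toDistribution g

theorem locallyIntegrable_kernel {d : ℕ} (hd : 1 ≤ d) {α : ℝ} (hα : 0 < α) :
    LocallyIntegrable (fun x : E d ↦ (kernel d α x : ℂ)) volume := by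
  apply locallyIntegrable_of_norm_le_rpow (α := d - 2 * α)
    (C := |Real.Gamma (d / 2 - α) / (4 ^ α * Real.pi ^ ((d : ℝ) / 2) * Real.Gamma α)|)
  · simpa using hα
  · refine Eventually.of_forall fun x ↦ ?_
    rw [Complex.norm_real, kernel, norm_mul, Real.norm_eq_abs, Real.norm_eq_abs, neg_sub,
      abs_of_nonneg (Real.rpow_nonneg (norm_nonneg x) _)]
  · apply Measurable.aestronglyMeasurable
    unfold kernel
    fun_prop
  · simpa using hd

theorem exists_schwartz_eq_rieszPotential {d : ℕ} (hd : 1 ≤ d) {α : ℝ} (hα : 0 < α)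
    {Ω : Set (E d)} (hΩ : Bornology.IsBounded Ω) (ψ : 𝓢(E d, ℂ)) (hψ : tsupport ψ ⊆ Ω) :
    ∃ g : 𝓢(E d, ℂ), ∀ᶠ x in 𝓝ˢ (closure Ω), g x = rieszPotential α ψ x := by
  have hc : HasCompactSupport ψ :=
    Metric.isCompact_of_isClosed_isBounded (isClosed_tsupport ψ) (hΩ.subset hψ)
  have hsmooth : ContDiff ℝ ∞ (rieszPotential (d := d) α ψ) := by
    have h := hc.contDiff_convolution_right (𝕜 := ℝ) (ContinuousLinearMap.mul ℝ ℂ)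
      (locallyIntegrable_kernel hd hα) (n := ⊤) (ψ.smooth ⊤)
    convert h using 1
    ext x
    rw [convolution_eq_swap]
    rfl
  obtain ⟨R, hR, hΩR⟩ := hΩ.closure.subset_ball_lt 0 0
  let χ : ContDiffBump (0 : E d) := ⟨R, R + 1, hR, by linarith⟩
  have h₁ : HasCompactSupport fun x ↦ (χ x : ℂ) * rieszPotential α ψ x :=
    (χ.hasCompactSupport.comp_left (g := fun r : ℝ ↦ (r : ℂ)) rfl).mul_right
  have h₂ : ContDiff ℝ ∞ fun x ↦ (χ x : ℂ) * rieszPotential α ψ x :=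
    (Complex.ofRealCLM.contDiff.comp χ.contDiff).mul hsmooth
  refine ⟨h₁.toSchwartzMap h₂, ?_⟩
  filter_upwards [Metric.isOpen_ball.mem_nhdsSet.mpr hΩR] with x hx
  have : χ x = 1 := χ.one_of_mem_closedBall (Metric.ball_subset_closedBall hx)
  simp [this]

end RieszPotential

end

noncomputable section

namespace RieszPotential

open scoped FourierTransform

/-! ### A compactly localised variant of the kernel -/

/-! Only the values of `φ_α` at differences of two points of a ball around `Ω` matter, so `φ_α` may
be changed far from the origin. With `a = d/2 - α`, the Gamma integral gives `Γ(a) |x|^{2α-d} = ∫₀^∞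
t^{a-1} e^{-t|x|²} dt`. The part over `t ≤ 1` is smooth in `|x|²` and becomes a Schwartz function
after a cut-off. The part over `t > 1` is a superposition of Gaussians that has all moments, and its
Fourier transform, a multiple of `∫₁^∞ t^{-α-1} e^{-π²|ξ|²/t} dt`, is `O((1+|ξ|²)^{-α})`. The sum,
suitably scaled, is a kernel `K` that equals `φ_α` near the origin (`exists_localKernel`).
Convolution with `K` is a Fourier multiplier of order `-2α`, hence continuous from `H^{s-2α}` to
`H^s`. Tested on `Ω`, it agrees with the Riesz potential on distributions supported in the closure
of `Ω`; this is the first claim (`exists_rieszPotential_supported`).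

The second claim follows by composing with extension by zero, provided that this is bounded from
`H^t(Ω)` to `H̃^t(Ω)` for `0 ≤ t < 1/2` (`exists_zeroExtension`), that is, provided that the
indicator function of `Ω` is a multiplier on `H^t`. For `t > 0` the `H^t` norm is equivalent to the
`L²` norm plus Gagliardo seminorms in the coordinate directions. Cutting off at the boundary adds to
these at most a multiple of `∫_Ω |f|² dist(x, Ωᶜ)^{-2t} dx` (`directionalEnergy_indicator_le`). That
integral is controlled by a fractional Hardy inequality along a direction transversal to the
boundary graph (`hardy_inequality`). For `t < 1/2` it needs no boundary condition on `f`. -/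

/-- The Fourier transform of a function all of whose moments are finite has temperate growth. -/
theorem hasTemperateGrowth_fourier {d : ℕ} {f : E d → ℂ} (hm : AEStronglyMeasurable f volume)
    (hf : ∀ n : ℕ, Integrable fun x ↦ ‖x‖ ^ n * ‖f x‖) : (𝓕 f).HasTemperateGrowth := by
  refine ⟨Real.contDiff_fourier fun n _ ↦ hf n, fun n ↦
    ⟨0, ∫ x, (2 * Real.pi * ‖innerSL ℝ (E := E d)‖) ^ n * (‖x‖ ^ n * ‖f x‖), fun ξ ↦ ?_⟩⟩
  rw [Real.iteratedFDeriv_fourier (N := ⊤) (fun n _ ↦ hf n) hm le_top, pow_zero, mul_one]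
  refine (VectorFourier.norm_fourierIntegral_le_integral_norm _ _ _ _ _).trans ?_
  refine integral_mono_of_nonneg (Eventually.of_forall fun x ↦ norm_nonneg _)
    ((hf n).const_mul _) (Eventually.of_forall fun x ↦ ?_)
  refine (VectorFourier.norm_fourierPowSMulRight_le _ _ _ _).trans_eq ?_
  ring

/-! ### Splitting the Gamma integral at `t = 1`. -/

/-- The part `∫₀¹ t^{a-1} e^{-tr} dt` of the Gamma integral. -/
def gammaHead (a r : ℝ) : ℝ := ∫ t in Ioc (0 : ℝ) 1, t ^ (a - 1) * Real.exp (-(r * t))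

/-- The part `∫₁^∞ t^{a-1} e^{-tr} dt` of the Gamma integral. -/
def gammaTail (a r : ℝ) : ℝ := ∫ t in Ioi (1 : ℝ), t ^ (a - 1) * Real.exp (-(r * t))

theorem gammaHead_add_gammaTail {a r : ℝ} (ha : 0 < a) (hr : 0 < r) :
    gammaHead a r + gammaTail a r = (1 / r) ^ a * Real.Gamma a := by
  have hint : IntegrableOn (fun t : ℝ ↦ t ^ (a - 1) * Real.exp (-(r * t))) (Ioi 0) := by
    -- A non-integrable function has integral `0` by convention, whereas the Gamma integral is
    -- positive.
    by_contra h
    have h₁ := Real.integral_rpow_mul_exp_neg_mul_Ioi ha hr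
    rw [integral_undef h] at h₁
    have := Real.Gamma_pos_of_pos ha
    have : 0 < (1 / r) ^ a * Real.Gamma a := by positivity
    linarith
  rw [← Real.integral_rpow_mul_exp_neg_mul_Ioi ha hr, ← Ioc_union_Ioi_eq_Ioi (zero_le_one' ℝ),
    setIntegral_union (Ioc_disjoint_Ioi le_rfl) measurableSet_Ioi]
  · rfl
  · exact hint.mono_set Ioc_subset_Ioi_self
  · exact hint.mono_set (Ioi_subset_Ioi zero_le_one)

/-- Up to the sign of the argument this is the moment generating function of the measure `t^{a-1}
dt` on `(0, 1]`. Bounded support makes all exponential moments finite, so the function is analytic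
on all of `ℝ`, in particular at `r = 0`, that is, at `x = 0` when `r = ‖x‖²`. -/
theorem contDiff_gammaHead {a : ℝ} (ha : 0 < a) : ContDiff ℝ ∞ (gammaHead a) := by
  let μ : Measure ℝ :=
    (volume.restrict (Ioc (0 : ℝ) 1)).withDensity fun t ↦ ENNReal.ofReal (t ^ (a - 1))
  have hmeas : Measurable fun t : ℝ ↦ (t ^ (a - 1)).toNNReal := by fun_prop
  have hbase : IntegrableOn (fun t : ℝ ↦ t ^ (a - 1)) (Ioc 0 1) := by
    rw [← intervalIntegrable_iff_integrableOn_Ioc_of_le zero_le_one]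
    exact intervalIntegral.intervalIntegrable_rpow' (by linarith)
  have hset : ProbabilityTheory.integrableExpSet id μ = univ := by
    ext r
    simp only [mem_univ, iff_true]
    change Integrable (fun t : ℝ ↦ Real.exp (r * t)) μ
    refine (integrable_withDensity_iff_integrable_smul hmeas).mpr ?_
    refine (hbase.norm.mul_const (Real.exp |r|)).mono' (by fun_prop) ?_
    filter_upwards [ae_restrict_mem measurableSet_Ioc] with t ht
    have : (0 : ℝ) ≤ t ^ (a - 1) := Real.rpow_nonneg ht.1.le _
    rw [NNReal.smul_def, norm_smul, Real.coe_toNNReal _ this, Real.norm_of_nonneg (Real.exp_pos _).le]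
    gcongr
    calc r * t ≤ |r * t| := le_abs_self _
      _ = |r| * t := by rw [abs_mul, abs_of_pos ht.1]
      _ ≤ |r| := mul_le_of_le_one_right (abs_nonneg _) ht.2
  have han : ContDiff ℝ ∞ (ProbabilityTheory.mgf id μ) := by
    have h := ProbabilityTheory.analyticOnNhd_mgf (X := id) (μ := μ)
    rw [hset, interior_univ] at h
    exact contDiffOn_univ.mp (h.contDiffOn uniqueDiffOn_univ)
  have heq : gammaHead a = fun r ↦ ProbabilityTheory.mgf id μ (-r) := by
    ext r
    change _ = ∫ t : ℝ, Real.exp (-r * t) ∂μ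
    refine Eq.trans ?_ (integral_withDensity_eq_integral_smul hmeas _).symm
    refine setIntegral_congr_fun measurableSet_Ioc fun t ht ↦ ?_
    have : (0 : ℝ) ≤ t ^ (a - 1) := Real.rpow_nonneg ht.1.le _
    simp [NNReal.smul_def, Real.coe_toNNReal _ this]
  rw [heq]
  exact han.comp contDiff_neg

theorem exists_pow_mul_exp_neg_le (n : ℕ) :
    ∃ C : ℝ, 0 ≤ C ∧ ∀ x : ℝ, 0 ≤ x → x ^ n * Real.exp (-x ^ 2) ≤ C * Real.exp (-(x ^ 2 / 2)) := by
  -- `2^n n!` comes from `y^n / n! ≤ e^y` at `y = x²/2`, for `x ≥ 1`; the summand `1` covers `x ≤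
  -- 1`.
  refine ⟨(2 ^ n * n.factorial : ℝ) + 1, by positivity, fun x hx ↦ ?_⟩
  have h₀ : Real.exp (-x ^ 2) = Real.exp (-(x ^ 2 / 2)) * Real.exp (-(x ^ 2 / 2)) := by
    rw [← Real.exp_add]; ring_nf
  rw [h₀, ← mul_assoc]
  gcongr
  rw [Real.exp_neg, ← div_eq_mul_inv, div_le_iff₀ (Real.exp_pos _)]
  rcases le_total x 1 with h | h
  · have h₁ : x ^ n ≤ 1 := pow_le_one₀ hx h
    have h₂ : 1 ≤ Real.exp (x ^ 2 / 2) := Real.one_le_exp (by positivity)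
    have h₃ : (0 : ℝ) ≤ 2 ^ n * n.factorial := by positivity
    nlinarith
  · have h₁ := Real.pow_div_factorial_le_exp (x ^ 2 / 2) (by positivity) n
    rw [div_le_iff₀ (by positivity), div_pow, div_le_iff₀ (by positivity)] at h₁
    have h₂ : x ^ n ≤ (x ^ 2) ^ n := by
      gcongr
      nlinarith
    have := Real.exp_pos (x ^ 2 / 2)
    nlinarith

theorem integrable_exp_neg_mul_norm_sq {d : ℕ} {b : ℝ} (hb : 0 < b) :
    Integrable fun x : E d ↦ Real.exp (-b * ‖x‖ ^ 2) := by
  by_contra h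
  have h₁ := GaussianFourier.integral_rexp_neg_mul_sq_norm (V := E d) hb
  rw [integral_undef h] at h₁
  have := Real.pi_pos
  have : 0 < (Real.pi / b) ^ ((Module.finrank ℝ (E d) : ℝ) / 2) := by positivity
  linarith

/-- Joint integrability of the Gaussian superposition that defines the tail, with all moments. -/
theorem integrable_prod_rpow_mul_exp {d : ℕ} {a : ℝ} (ha : a < d / 2) (n : ℕ) :
    Integrable (fun p : ℝ × E d ↦ p.1 ^ (a - 1) * (‖p.2‖ ^ n * Real.exp (-(‖p.2‖ ^ 2 * p.1))))
      ((volume.restrict (Ioi 1)).prod volume) := by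
  obtain ⟨C, hC₀, hC⟩ := exists_pow_mul_exp_neg_le n
  -- A factor `e^{-‖x‖²}` is split off to absorb the power of `‖x‖`. The exponent that is left has
  -- coefficient `t - 1/2`, which is at least `t/2` because `t > 1`.
  have hbound : ∀ t ∈ Ioi (1 : ℝ), ∀ x : E d, ‖x‖ ^ n * Real.exp (-(‖x‖ ^ 2 * t)) ≤
      C * Real.exp (-(t / 2) * ‖x‖ ^ 2) := by
    intro t ht x
    have ht : 1 < t := ht
    have h₁ := hC ‖x‖ (norm_nonneg x)
    calc ‖x‖ ^ n * Real.exp (-(‖x‖ ^ 2 * t))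
        = (‖x‖ ^ n * Real.exp (-‖x‖ ^ 2)) * Real.exp (-(‖x‖ ^ 2 * (t - 1))) := by
          rw [mul_assoc, ← Real.exp_add]; ring_nf
      _ ≤ (C * Real.exp (-(‖x‖ ^ 2 / 2))) * Real.exp (-(‖x‖ ^ 2 * (t - 1))) := by gcongr
      _ = C * Real.exp (-(‖x‖ ^ 2 / 2) + -(‖x‖ ^ 2 * (t - 1))) := by
          rw [mul_assoc, ← Real.exp_add]
      _ ≤ C * Real.exp (-(t / 2) * ‖x‖ ^ 2) := by
          gcongr
          nlinarith [sq_nonneg ‖x‖]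
  have hmeas : Measurable
      (fun p : ℝ × E d ↦ p.1 ^ (a - 1) * (‖p.2‖ ^ n * Real.exp (-(‖p.2‖ ^ 2 * p.1)))) := by
    fun_prop
  have hint : ∀ t ∈ Ioi (1 : ℝ), Integrable fun x : E d ↦
      ‖x‖ ^ n * Real.exp (-(‖x‖ ^ 2 * t)) := by
    intro t ht
    refine ((integrable_exp_neg_mul_norm_sq (b := t / 2) ?_).const_mul C).mono'
      (by fun_prop) (Eventually.of_forall fun x ↦ ?_)
    · have : 1 < t := ht
      linarith
    · rw [Real.norm_of_nonneg (by positivity)]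
      exact hbound t ht x
  rw [integrable_prod_iff hmeas.aestronglyMeasurable]
  refine ⟨?_, ?_⟩
  · filter_upwards [ae_restrict_mem measurableSet_Ioi] with t ht
    exact (hint t ht).const_mul _
  -- Integrating the Gaussian in `x` contributes `t^{-d/2}`; the resulting exponent is below `-1`
  -- exactly because `a < d/2`.
  · refine ((integrableOn_Ioi_rpow_of_lt (a := a - 1 - d / 2) (by linarith)
      zero_lt_one).const_mul (C * (2 * Real.pi) ^ ((d : ℝ) / 2))).mono' ?_ ?_
    · exact (hmeas.norm.stronglyMeasurable.integral_prod_right').aestronglyMeasurable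
    · filter_upwards [ae_restrict_mem measurableSet_Ioi] with t ht
      have ht' : 0 < t := lt_trans zero_lt_one ht
      rw [Real.norm_of_nonneg (integral_nonneg fun x ↦ norm_nonneg _)]
      have h₁ := GaussianFourier.integral_rexp_neg_mul_sq_norm (V := E d) (half_pos ht')
      rw [finrank_euclideanSpace_fin] at h₁
      calc ∫ x : E d, ‖t ^ (a - 1) * (‖x‖ ^ n * Real.exp (-(‖x‖ ^ 2 * t)))‖
          = t ^ (a - 1) * ∫ x : E d, ‖x‖ ^ n * Real.exp (-(‖x‖ ^ 2 * t)) := by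
            rw [← integral_const_mul]
            congr with x
            rw [Real.norm_of_nonneg (by positivity)]
        _ ≤ t ^ (a - 1) * ∫ x : E d, C * Real.exp (-(t / 2) * ‖x‖ ^ 2) := by
            gcongr
            · exact hint t ht
            · exact (integrable_exp_neg_mul_norm_sq (half_pos ht')).const_mul C
            · exact fun x ↦ hbound t ht x
        _ = C * (2 * Real.pi) ^ ((d : ℝ) / 2) * t ^ (a - 1 - d / 2) := by
            rw [integral_const_mul, h₁, Real.rpow_sub ht' (a - 1), div_div_eq_mul_div,
              mul_comm Real.pi, Real.div_rpow (by positivity) ht'.le]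
            ring

theorem integrable_norm_pow_mul_gammaTail {d : ℕ} {a : ℝ} (ha : a < d / 2) (n : ℕ) :
    Integrable fun x : E d ↦ ‖x‖ ^ n * gammaTail a (‖x‖ ^ 2) := by
  refine (integrable_prod_rpow_mul_exp ha n).integral_prod_right.congr
    (Eventually.of_forall fun x ↦ ?_)
  simp only [gammaTail]
  rw [← integral_const_mul]
  congr with t
  ring

theorem gammaTail_nonneg (a r : ℝ) : 0 ≤ gammaTail a r :=
  setIntegral_nonneg measurableSet_Ioi fun _ ht ↦
    mul_nonneg (Real.rpow_nonneg (zero_le_one.trans (le_of_lt ht)) _) (Real.exp_pos _).le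

/-! ### Fourier decay of the tail. -/

/-- The exponential suppresses the range `t < X`. On `(1, X]` the bound `y^{α+1} ≤ y² ≤ 2e^y` for `y
= X/t ≥ 1` makes the integrand at most `2X^{-α-1}`, which gives the `2`; on `(X, ∞)` the exponential
is dropped, which gives the `1/α`. -/
theorem setIntegral_rpow_mul_exp_neg_div_le {α X : ℝ} (h₀ : 0 < α) (h₁ : α < 1) (hX : 1 ≤ X) :
    ∫ t in Ioi (1 : ℝ), t ^ (-α - 1) * Real.exp (-(X / t)) ≤ (2 + 1 / α) * X ^ (-α) := by
  have hX₀ : 0 < X := by linarith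
  have hint : IntegrableOn (fun t : ℝ ↦ t ^ (-α - 1) * Real.exp (-(X / t))) (Ioi 1) := by
    refine (integrableOn_Ioi_rpow_of_lt (a := -α - 1) (by linarith) zero_lt_one).mono'
      (by fun_prop) ?_
    filter_upwards [ae_restrict_mem measurableSet_Ioi] with t ht
    have ht : 0 < t := lt_trans zero_lt_one ht
    rw [Real.norm_of_nonneg (by positivity)]
    refine mul_le_of_le_one_right (by positivity) (Real.exp_le_one_iff.mpr ?_)
    rw [neg_nonpos]
    positivity
  rw [← Ioc_union_Ioi_eq_Ioi hX, setIntegral_union (Ioc_disjoint_Ioi le_rfl) measurableSet_Ioi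
    (hint.mono_set Ioc_subset_Ioi_self) (hint.mono_set (Ioi_subset_Ioi hX)), add_mul]
  gcongr
  · calc ∫ t in Ioc 1 X, t ^ (-α - 1) * Real.exp (-(X / t))
        ≤ ∫ t in Ioc 1 X, 2 * X ^ (-α - 1) := by
          refine setIntegral_mono_on (hint.mono_set Ioc_subset_Ioi_self)
            (integrableOn_const measure_Ioc_lt_top.ne) measurableSet_Ioc fun t ht ↦ ?_
          have ht₀ : 0 < t := lt_trans zero_lt_one ht.1
          have hy : 1 ≤ X / t := (one_le_div ht₀).mpr ht.2
          have h₂ : (X / t) ^ (α + 1) ≤ 2 * Real.exp (X / t) := by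
            calc (X / t) ^ (α + 1) ≤ (X / t) ^ (2 : ℝ) :=
                  Real.rpow_le_rpow_of_exponent_le hy (by linarith)
              _ = 2 * ((X / t) ^ 2 / (Nat.factorial 2)) := by
                  rw [Real.rpow_two]; simp [Nat.factorial]; ring
              _ ≤ 2 * Real.exp (X / t) := by
                  gcongr
                  exact Real.pow_div_factorial_le_exp _ (by positivity) 2
          have h₃ : t ^ (-α - 1) = X ^ (-α - 1) * (X / t) ^ (α + 1) := by
            rw [Real.div_rpow hX₀.le ht₀.le, ← mul_div_assoc, ← Real.rpow_add hX₀,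
              show -α - 1 = -(α + 1) by ring, Real.rpow_neg ht₀.le]
            simp
          rw [h₃, mul_assoc, mul_comm 2]
          gcongr
          rw [Real.exp_neg, ← div_eq_mul_inv, div_le_iff₀ (Real.exp_pos _)]
          exact h₂
      _ ≤ 2 * X ^ (-α) := by
          rw [setIntegral_const, Real.volume_real_Ioc_of_le hX, smul_eq_mul,
            Real.rpow_sub hX₀, Real.rpow_one]
          have : 0 < X ^ (-α) := by positivity
          rw [show (X - 1) * (2 * (X ^ (-α) / X)) = 2 * X ^ (-α) * ((X - 1) / X) by ring]
          refine mul_le_of_le_one_right (by positivity) ?_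
          rw [div_le_one hX₀]
          linarith
  · calc ∫ t in Ioi X, t ^ (-α - 1) * Real.exp (-(X / t))
        ≤ ∫ t in Ioi X, t ^ (-α - 1) := by
          refine setIntegral_mono_on (hint.mono_set (Ioi_subset_Ioi hX))
            (integrableOn_Ioi_rpow_of_lt (by linarith) hX₀) measurableSet_Ioi fun t ht ↦ ?_
          have ht₀ : 0 < t := hX₀.trans ht
          refine mul_le_of_le_one_right (by positivity) (Real.exp_le_one_iff.mpr ?_)
          rw [neg_nonpos]
          positivity
      _ = 1 / α * X ^ (-α) := by
          rw [integral_Ioi_rpow_of_lt (by linarith) hX₀]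
          simp
          field_simp

theorem fourier_gammaTail {d : ℕ} {a : ℝ} (ha : a < d / 2) (ξ : E d) :
    𝓕 (fun x : E d ↦ (gammaTail a (‖x‖ ^ 2) : ℂ)) ξ =
      ∫ t in Ioi (1 : ℝ), ((t ^ (a - 1) * ((Real.pi / t) ^ ((d : ℝ) / 2) *
        Real.exp (-(Real.pi ^ 2 * ‖ξ‖ ^ 2 / t))) : ℝ) : ℂ) := by
  have hprod : Integrable (Function.uncurry fun (x : E d) (t : ℝ) ↦
      Complex.exp (↑(-2 * Real.pi * inner ℝ x ξ) * Complex.I) *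
        ((t ^ (a - 1) * Real.exp (-(‖x‖ ^ 2 * t)) : ℝ) : ℂ))
      (volume.prod (volume.restrict (Ioi 1))) := by
    have h := (integrable_prod_rpow_mul_exp ha 0).swap
    refine h.norm.mono' ?_ (Eventually.of_forall fun p ↦ ?_)
    · apply Measurable.aestronglyMeasurable
      unfold Function.uncurry
      fun_prop
    · simp [Function.uncurry, Complex.norm_exp, -Complex.ofReal_pow]
  calc 𝓕 (fun x : E d ↦ (gammaTail a (‖x‖ ^ 2) : ℂ)) ξ
      = ∫ x : E d, ∫ t in Ioi (1 : ℝ),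
          Complex.exp (↑(-2 * Real.pi * inner ℝ x ξ) * Complex.I) *
            ((t ^ (a - 1) * Real.exp (-(‖x‖ ^ 2 * t)) : ℝ) : ℂ) := by
        rw [Real.fourier_eq']
        congr with x
        rw [integral_const_mul, integral_complex_ofReal]
        rfl
    _ = ∫ t in Ioi (1 : ℝ), ∫ x : E d,
          Complex.exp (↑(-2 * Real.pi * inner ℝ x ξ) * Complex.I) *
            ((t ^ (a - 1) * Real.exp (-(‖x‖ ^ 2 * t)) : ℝ) : ℂ) := integral_integral_swap hprod
    _ = _ := by
        refine setIntegral_congr_fun measurableSet_Ioi fun t ht ↦ ?_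
        have ht₀ : 0 < t := lt_trans zero_lt_one ht
        have h := fourier_gaussian_innerProductSpace (V := E d) (b := t) (by simpa using ht₀) ξ
        rw [Real.fourier_eq'] at h
        calc _ = ∫ x : E d, ((t ^ (a - 1) : ℝ) : ℂ) *
              (Complex.exp (↑(-2 * Real.pi * inner ℝ x ξ) * Complex.I) •
                Complex.exp (-(t : ℂ) * ‖x‖ ^ 2)) := by
              congr with x
              push_cast
              rw [smul_eq_mul, show -(t : ℂ) * ‖x‖ ^ 2 = -(‖x‖ ^ 2 * t) by ring]
              ring
          _ = _ := by
              rw [integral_const_mul, h, finrank_euclideanSpace_fin]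
              have hc : (((Real.pi / t) ^ ((d : ℝ) / 2) : ℝ) : ℂ) =
                  ((Real.pi : ℂ) / t) ^ ((d : ℂ) / 2) := by
                rw [Complex.ofReal_cpow (by positivity)]
                push_cast
                rfl
              rw [← hc]
              push_cast
              congr 3
              ring

/-- The factor `t^{-d/2}` from the transform of a Gaussian turns `t^{d/2-α-1}` into `t^{-α-1}`, so
the dimension disappears from the decay rate. -/
theorem norm_fourier_gammaTail_le {d : ℕ} {α : ℝ} (h₀ : 0 < α) (h₁ : α < 1) :
    ∃ C : ℝ, ∀ ξ : E d, ‖𝓕 (fun x : E d ↦ (gammaTail (d / 2 - α) (‖x‖ ^ 2) : ℂ)) ξ‖ ≤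
      C * (1 + ‖ξ‖ ^ 2) ^ (-α) := by
  refine ⟨Real.pi ^ ((d : ℝ) / 2) * Real.exp 1 * (2 + 1 / α), fun ξ ↦ ?_⟩
  rw [fourier_gammaTail (by linarith)]
  have hX : 1 ≤ 1 + ‖ξ‖ ^ 2 := by nlinarith [sq_nonneg ‖ξ‖]
  have hpi := Real.pi_gt_three
  refine (norm_integral_le_integral_norm _).trans ?_
  calc _ ≤ ∫ t in Ioi (1 : ℝ), Real.pi ^ ((d : ℝ) / 2) * Real.exp 1 *
        (t ^ (-α - 1) * Real.exp (-((1 + ‖ξ‖ ^ 2) / t))) := by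
        refine integral_mono_of_nonneg (Eventually.of_forall fun t ↦ norm_nonneg _) ?_ ?_
        · refine Integrable.const_mul ?_ _
          refine (integrableOn_Ioi_rpow_of_lt (a := -α - 1) (by linarith) zero_lt_one).mono'
            (by fun_prop) ?_
          filter_upwards [ae_restrict_mem measurableSet_Ioi] with t ht
          have ht : 0 < t := lt_trans zero_lt_one ht
          rw [Real.norm_of_nonneg (by positivity)]
          refine mul_le_of_le_one_right (by positivity) (Real.exp_le_one_iff.mpr ?_)
          rw [neg_nonpos]
          positivity
        · filter_upwards [ae_restrict_mem measurableSet_Ioi] with t ht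
          have ht₁ : 1 < t := ht
          have ht₀ : 0 < t := lt_trans zero_lt_one ht
          rw [Complex.norm_real, Real.norm_of_nonneg (by positivity),
            Real.div_rpow Real.pi_pos.le ht₀.le]
          have h₂ : t ^ (-α - 1) = t ^ ((d : ℝ) / 2 - α - 1) / t ^ ((d : ℝ) / 2) := by
            rw [← Real.rpow_sub ht₀]; ring_nf
          -- Since `1/t ≤ 1`, the factor `e` pays for replacing `‖ξ‖²` by `1 + ‖ξ‖²` in the
          -- exponent.
          have h₃ : Real.exp (-(Real.pi ^ 2 * ‖ξ‖ ^ 2 / t)) ≤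
              Real.exp 1 * Real.exp (-((1 + ‖ξ‖ ^ 2) / t)) := by
            rw [← Real.exp_add]
            gcongr
            rw [add_div]
            have h₄ : 1 / t ≤ 1 := by rw [div_le_one ht₀]; exact ht₁.le
            have h₅ : ‖ξ‖ ^ 2 / t ≤ Real.pi ^ 2 * ‖ξ‖ ^ 2 / t := by
              gcongr
              exact le_mul_of_one_le_left (sq_nonneg _) (by nlinarith)
            linarith
          calc _ = Real.pi ^ ((d : ℝ) / 2) * t ^ (-α - 1) *
                Real.exp (-(Real.pi ^ 2 * ‖ξ‖ ^ 2 / t)) := by rw [h₂]; ring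
            _ ≤ Real.pi ^ ((d : ℝ) / 2) * t ^ (-α - 1) *
                (Real.exp 1 * Real.exp (-((1 + ‖ξ‖ ^ 2) / t))) := by gcongr
            _ = _ := by ring
    _ ≤ _ := by
        rw [integral_const_mul, mul_assoc (Real.pi ^ ((d : ℝ) / 2) * Real.exp 1)]
        gcongr
        exact setIntegral_rpow_mul_exp_neg_div_le h₀ h₁ hX

theorem norm_schwartz_le_rpow {d : ℕ} {α : ℝ} (h₁ : α < 1) (f : 𝓢(E d, ℂ)) :
    ∃ C : ℝ, ∀ ξ : E d, ‖f ξ‖ ≤ C * (1 + ‖ξ‖ ^ 2) ^ (-α) := by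
  obtain ⟨C₀, hC₀, h₀⟩ := f.decay 0 0
  obtain ⟨C₂, hC₂, h₂⟩ := f.decay 2 0
  refine ⟨C₀ + C₂, fun ξ ↦ ?_⟩
  have hX : 1 ≤ 1 + ‖ξ‖ ^ 2 := by nlinarith [sq_nonneg ‖ξ‖]
  have h₀ := h₀ ξ
  have h₂ := h₂ ξ
  simp only [norm_iteratedFDeriv_zero, pow_zero, one_mul] at h₀ h₂
  calc ‖f ξ‖ = ((1 + ‖ξ‖ ^ 2) * ‖f ξ‖) * (1 + ‖ξ‖ ^ 2) ^ (-1 : ℝ) := by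
        rw [Real.rpow_neg_one]; field_simp
    _ ≤ (C₀ + C₂) * (1 + ‖ξ‖ ^ 2) ^ (-α) := by
        gcongr
        · linarith

/-- There is an integrable even function with finite moments that coincides with the kernel `φ_α`
near the origin, and whose Fourier transform decays like `|ξ|^{-2α}`. -/
theorem exists_localKernel {d : ℕ} {α : ℝ} (h₀ : 0 < α) (h₁ : α < 1) (h₂ : 2 * α < d) {R : ℝ}
    (hR : 0 < R) :
    ∃ K : E d → ℂ, AEStronglyMeasurable K volume ∧
      (∀ n : ℕ, Integrable fun x ↦ ‖x‖ ^ n * ‖K x‖) ∧ (∀ x, K (-x) = K x) ∧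
      (∀ x, x ≠ 0 → ‖x‖ < R → K x = kernel d α x) ∧
      ∃ C : ℝ, ∀ ξ, ‖𝓕 K ξ‖ ≤ C * (1 + ‖ξ‖ ^ 2) ^ (-α) := by
  set a : ℝ := d / 2 - α with ha_def
  have ha : 0 < a := by linarith
  have ha' : a < d / 2 := by linarith
  let χ : ContDiffBump (0 : E d) := ⟨R, R + 1, hR, by linarith⟩
  have hg₁ : HasCompactSupport fun x : E d ↦ (χ x : ℂ) * (gammaHead a (‖x‖ ^ 2) : ℂ) :=
    (χ.hasCompactSupport.comp_left (g := fun r : ℝ ↦ (r : ℂ)) rfl).mul_right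
  have hg₂ : ContDiff ℝ ∞ fun x : E d ↦ (χ x : ℂ) * (gammaHead a (‖x‖ ^ 2) : ℂ) :=
    (Complex.ofRealCLM.contDiff.comp χ.contDiff).mul
      (Complex.ofRealCLM.contDiff.comp ((contDiff_gammaHead ha).comp (contDiff_norm_sq ℝ)))
  let g : 𝓢(E d, ℂ) := hg₁.toSchwartzMap hg₂
  -- The constant of `φ_α` without `Γ(d/2 - α)`, since that factor is supplied by the Gamma
  -- integral.
  let c : ℂ := ((1 / (4 ^ α * Real.pi ^ ((d : ℝ) / 2) * Real.Gamma α) : ℝ) : ℂ)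
  let τ : E d → ℂ := fun x ↦ (gammaTail a (‖x‖ ^ 2) : ℂ)
  have hτ : ∀ n : ℕ, Integrable fun x : E d ↦ ‖x‖ ^ n * ‖τ x‖ := by
    intro n
    refine (integrable_norm_pow_mul_gammaTail ha' n).congr (Eventually.of_forall fun x ↦ ?_)
    simp only [τ]
    rw [Complex.norm_real, Real.norm_of_nonneg (gammaTail_nonneg _ _)]
  have hτm : AEStronglyMeasurable τ volume := by
    have := (integrable_norm_pow_mul_gammaTail (d := d) ha' 0).aestronglyMeasurable
    simp only [pow_zero, one_mul] at this
    exact Complex.continuous_ofReal.comp_aestronglyMeasurable this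
  have hτi : Integrable τ volume := by
    rw [← integrable_norm_iff hτm]
    simpa using hτ 0
  have hm : AEStronglyMeasurable (c • ((g : E d → ℂ) + τ)) volume :=
    (g.continuous.aestronglyMeasurable.add hτm).const_smul c
  refine ⟨c • ((g : E d → ℂ) + τ), hm, fun n ↦ ?_, fun x ↦ ?_, fun x hx hxR ↦ ?_, ?_⟩
  · refine (((g.integrable_pow_mul volume n).add (hτ n)).const_mul ‖c‖).mono'
      ((by fun_prop : AEStronglyMeasurable (fun x : E d ↦ ‖x‖ ^ n) volume).mul hm.norm)
      (Eventually.of_forall fun x ↦ ?_)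
    rw [norm_mul, norm_norm, Pi.smul_apply, norm_smul, Real.norm_of_nonneg (by positivity)]
    simp only [Pi.add_apply]
    calc ‖x‖ ^ n * (‖c‖ * ‖g x + τ x‖) ≤ ‖x‖ ^ n * (‖c‖ * (‖g x‖ + ‖τ x‖)) := by
          gcongr
          exact norm_add_le _ _
      _ = _ := by ring
  · have hχ := χ.neg x
    simp [g, τ, hχ]
  · have hxχ : χ x = 1 := χ.one_of_mem_closedBall (by simpa using hxR.le)
    have hx₀ : 0 < ‖x‖ := norm_pos_iff.mpr hx
    have h := gammaHead_add_gammaTail ha (pow_pos hx₀ 2)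
    have hpow : (1 / ‖x‖ ^ 2) ^ a = ‖x‖ ^ (2 * α - d) := by
      rw [one_div, Real.inv_rpow (by positivity), ← Real.rpow_neg (by positivity),
        ← Real.rpow_natCast, ← Real.rpow_mul hx₀.le]
      congr 1
      push_cast
      rw [ha_def]
      ring
    have hval : (c • ((g : E d → ℂ) + τ)) x =
        c * ((gammaHead a (‖x‖ ^ 2) + gammaTail a (‖x‖ ^ 2) : ℝ) : ℂ) := by
      simp [g, τ, hxχ]
    rw [hval, h, hpow, kernel, ← ha_def]
    simp only [c]
    rw [← Complex.ofReal_mul]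
    congr 1
    ring
  · obtain ⟨C₁, hC₁⟩ := norm_schwartz_le_rpow h₁ (𝓕 g)
    obtain ⟨C₂, hC₂⟩ := norm_fourier_gammaTail_le (d := d) h₀ h₁
    refine ⟨‖c‖ * (C₁ + C₂), fun ξ ↦ ?_⟩
    have h : 𝓕 (c • ((g : E d → ℂ) + τ)) ξ = c • (𝓕 g ξ + 𝓕 τ ξ) := by
      rw [SchwartzMap.fourier_coe]
      simp only [Real.fourier_eq, Pi.smul_apply, Pi.add_apply]
      rw [← integral_add (f := fun v ↦ Real.fourierChar (-inner ℝ v ξ) • g v), ← integral_smul]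
      · congr with v
        rw [← smul_add, smul_comm]
      · exact (Real.fourierIntegral_convergent_iff ξ).mpr g.integrable
      · exact (Real.fourierIntegral_convergent_iff ξ).mpr hτi
    rw [h, norm_smul, mul_assoc]
    gcongr
    refine (norm_add_le _ _).trans ?_
    rw [add_mul]
    exact add_le_add (hC₁ ξ) (hC₂ ξ)

open TemperedDistribution

/-! ### Fourier multipliers between Sobolev spaces -/

/-- Plancherel and the product of an `L^∞` with an `L²` function. Temperate growth only serves to
make the multiplier act on tempered distributions. -/
theorem exists_lp_fourierMultiplier {d : ℕ} {m : E d → ℂ} (hm : m.HasTemperateGrowth) {C : ℝ}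
    (hC : 0 ≤ C) (hb : ∀ ξ, ‖m ξ‖ ≤ C) (g : Lp ℂ 2 (volume : Measure (E d))) :
    ∃ h : Lp ℂ 2 (volume : Measure (E d)), fourierMultiplierCLM ℂ m (g : 𝓢'(E d, ℂ)) = h ∧
      ‖h‖ ≤ C * ‖g‖ := by
  have hm' : MemLp m ⊤ (volume : Measure (E d)) :=
    memLp_top_of_bound hm.1.continuous.aestronglyMeasurable C (Eventually.of_forall hb)
  let p : Lp ℂ 2 (volume : Measure (E d)) := (hm'.toLp m) • (𝓕 g : Lp ℂ 2 (volume : Measure (E d)))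
  refine ⟨𝓕⁻ p, ?_, ?_⟩
  · rw [fourierMultiplierCLM_apply, Lp.fourier_toTemperedDistribution_eq,
      ← Lp.toTemperedDistribution_smul_eq (r := 2) hm hm', Lp.fourierInv_toTemperedDistribution_eq]
  · rw [← Lp.norm_fourier_eq, FourierTransform.fourier_fourierInv_eq]
    refine (Lp.norm_smul_le _ _).trans ?_
    rw [Lp.norm_fourier_eq]
    gcongr
    rw [Lp.norm_toLp, eLpNorm_exponent_top]
    exact ENNReal.toReal_le_of_le_ofReal hC
      (eLpNormEssSup_le_of_ae_bound (Eventually.of_forall hb))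

/-- Symbols of composed multipliers multiply. If `k` has order `-β`, the symbol on the right is
bounded, so the question of continuity is reduced to `L²`. -/
theorem besselPotential_fourierMultiplierCLM {d : ℕ} {k : E d → ℂ} (hk : k.HasTemperateGrowth)
    (β t : ℝ) (u : 𝓢'(E d, ℂ)) :
    besselPotential (E d) ℂ (t + β) (fourierMultiplierCLM ℂ k u) =
      fourierMultiplierCLM ℂ (fun ξ ↦ k ξ * ((1 + ‖ξ‖ ^ 2) ^ (β / 2) : ℝ))
        (besselPotential (E d) ℂ t u) := by
  simp only [besselPotential]
  rw [fourierMultiplierCLM_fourierMultiplierCLM_apply hk (by fun_prop),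
    fourierMultiplierCLM_fourierMultiplierCLM_apply (by fun_prop) (by fun_prop)]
  congr 1
  congr 1
  ext ξ
  simp only [Pi.mul_apply]
  rw [mul_left_comm, ← Complex.ofReal_mul, ← Real.rpow_add (by positivity)]
  congr 4
  ring

theorem SobolevSpace.norm_eq {d : ℕ} {s : ℝ} (u : SobolevSpace d s) :
    ‖u‖ = ‖SobolevSpace.bessel u‖ := rfl

theorem SobolevSpace.bessel_eq_of {d : ℕ} {s : ℝ} {u : SobolevSpace d s}
    {h : Lp ℂ 2 (volume : Measure (E d))}
    (hu : besselPotential (E d) ℂ s u.toDistribution = h) : SobolevSpace.bessel u = h := by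
  apply SobolevSpace.lp_toDistribution_injective
  rw [← SobolevSpace.bessel_spec, hu]
  rfl

/-- A Fourier multiplier with a symbol of order `-β` maps `H^t` continuously to `H^{t+β}`. -/
theorem exists_sobolev_fourierMultiplier {d : ℕ} {k : E d → ℂ} (hk : k.HasTemperateGrowth)
    {β C : ℝ} (hC : ∀ ξ, ‖k ξ‖ ≤ C * (1 + ‖ξ‖ ^ 2) ^ (-(β / 2))) {s t : ℝ} (hst : t + β = s) :
    ∃ M : SobolevSpace d t →L[ℂ] SobolevSpace d s, ∀ u,
      (M u).toDistribution = fourierMultiplierCLM ℂ k u.toDistribution := by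
  subst hst
  have hC₀ : 0 ≤ C := by
    have := (norm_nonneg _).trans (hC 0)
    simpa using this
  have hm : (fun ξ : E d ↦ k ξ * ((1 + ‖ξ‖ ^ 2) ^ (β / 2) : ℝ)).HasTemperateGrowth := by
    fun_prop
  have hb : ∀ ξ : E d, ‖k ξ * ((1 + ‖ξ‖ ^ 2) ^ (β / 2) : ℝ)‖ ≤ C := by
    intro ξ
    have hX : 0 < 1 + ‖ξ‖ ^ 2 := by positivity
    rw [norm_mul, Complex.norm_real, Real.norm_of_nonneg (by positivity)]
    calc ‖k ξ‖ * (1 + ‖ξ‖ ^ 2) ^ (β / 2)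
        ≤ C * (1 + ‖ξ‖ ^ 2) ^ (-(β / 2)) * (1 + ‖ξ‖ ^ 2) ^ (β / 2) := by
          gcongr
          exact hC ξ
      _ = C := by rw [mul_assoc, ← Real.rpow_add hX]; simp
  have key : ∀ u : SobolevSpace d t, ∃ h : Lp ℂ 2 (volume : Measure (E d)),
      besselPotential (E d) ℂ (t + β) (fourierMultiplierCLM ℂ k u.toDistribution) = h ∧
        ‖h‖ ≤ C * ‖u‖ := by
    intro u
    rw [besselPotential_fourierMultiplierCLM hk, SobolevSpace.bessel_spec]
    exact exists_lp_fourierMultiplier hm hC₀ hb _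
  let M₀ : SobolevSpace d t →ₗ[ℂ] SobolevSpace d (t + β) :=
    LinearMap.codRestrict (sobolevSubmodule d (t + β))
      ((fourierMultiplierCLM ℂ k).toLinearMap ∘ₗ SobolevSpace.toDistribution)
      fun u ↦ (key u).imp fun _ h ↦ h.1
  have hM₀ : ∀ u, (M₀ u).toDistribution = fourierMultiplierCLM ℂ k u.toDistribution :=
    fun _ ↦ rfl
  refine ⟨M₀.mkContinuous C fun u ↦ ?_, hM₀⟩
  obtain ⟨h, h₁, h₂⟩ := key u
  rwa [SobolevSpace.norm_eq, SobolevSpace.bessel_eq_of (u := M₀ u) h₁]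

/-! ### Convolution with an integrable kernel as a Fourier multiplier -/

/-- The left side is how the transpose of the multiplier acts on a test function; here it is
identified with `K * ψ`. The multiplication formula moves the Fourier transform from `K` to the
modulated `𝓕⁻ ψ`, and evenness of `K` turns the resulting correlation into a convolution. -/
theorem fourier_smulLeftCLM_fourierInv_apply {d : ℕ} {K : E d → ℂ} (hK : Integrable K)
    (heven : ∀ x, K (-x) = K x) (hk : (𝓕 K).HasTemperateGrowth) (ψ : 𝓢(E d, ℂ)) (x : E d) :
    𝓕 (SchwartzMap.smulLeftCLM ℂ (𝓕 K) (𝓕⁻ ψ)) x = ∫ y, K (x - y) * ψ y := by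
  let G : E d → ℂ := fun ξ ↦ Real.fourierChar (-inner ℝ ξ x) • (𝓕⁻ ψ) ξ
  have hG : Integrable G := (Real.fourierIntegral_convergent_iff x).mpr (𝓕⁻ ψ).integrable
  calc 𝓕 (SchwartzMap.smulLeftCLM ℂ (𝓕 K) (𝓕⁻ ψ)) x
      = ∫ ξ, 𝓕 K ξ • G ξ := by
        rw [SchwartzMap.fourier_coe, Real.fourier_eq]
        congr with ξ
        rw [SchwartzMap.smulLeftCLM_apply_apply hk, smul_comm]
    _ = ∫ y, K y • 𝓕 G y := by
        simpa using! VectorFourier.integral_fourierIntegral_smul_eq_flip (L := innerₗ (E d))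
          Real.continuous_fourierChar continuous_inner hK hG
    _ = ∫ y, K y * ψ (x + y) := by
        congr with y
        rw [smul_eq_mul]
        congr 1
        have h : 𝓕 (𝓕⁻ ψ) (x + y) = ψ (x + y) := by
          rw [FourierTransform.fourier_fourierInv_eq]
        rw [← h, SchwartzMap.fourier_coe, Real.fourier_eq, Real.fourier_eq]
        congr with ξ
        rw [smul_smul, ← AddChar.map_add_eq_mul, inner_add_right, neg_add_rev]
    _ = ∫ y, K (x - y) * ψ y := by
        rw [← integral_add_left_eq_self (fun y ↦ K (x - y) * ψ y) x]
        congr with y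
        rw [sub_add_cancel_left, heven]

/-! ### The Riesz potential as a map of Sobolev spaces -/

/-- The local kernel matches `φ_α` only off the origin, so the diagonal has to be a null set; `d ≥
1` ensures this. -/
theorem ae_ne (d : ℕ) (hd : 1 ≤ d) (x : E d) : ∀ᵐ y : E d, x - y ≠ 0 := by
  have : Nonempty (Fin d) := ⟨⟨0, hd⟩⟩
  filter_upwards [compl_mem_ae_iff.mpr (measure_singleton (μ := (volume : Measure (E d))) x)]
    with y hy h
  exact hy (sub_eq_zero.mp h).symm

/-- Two points of the ball of radius `r` differ by less than `2r`, where the two kernels coincide.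
-/
theorem rieszPotential_eq_localKernel {d : ℕ} (hd : 1 ≤ d) {α r : ℝ} {K : E d → ℂ}
    (hK : ∀ x, x ≠ 0 → ‖x‖ < 2 * r → K x = kernel d α x) {f : E d → ℂ}
    (hf : ∀ᵐ y, y ∉ Metric.ball (0 : E d) r → f y = 0) {x : E d} (hx : x ∈ Metric.ball 0 r) :
    rieszPotential α f x = ∫ y, K (x - y) * f y := by
  refine integral_congr_ae ?_
  filter_upwards [ae_ne d hd x, hf] with y hy hfy
  by_cases h : y ∈ Metric.ball 0 r
  · rw [hK (x - y) hy]
    have h₁ := norm_sub_le x y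
    rw [mem_ball_zero_iff] at h hx
    linarith
  · rw [hfy h, mul_zero, mul_zero]

/-- Fubini: convolution with an even kernel is its own transpose. -/
theorem integral_mul_conv_comm {d : ℕ} {K : E d → ℂ} (hK : Integrable K)
    (heven : ∀ x, K (-x) = K x) (ψ : 𝓢(E d, ℂ)) {f : E d → ℂ} (hf : Integrable f) :
    ∫ x, (∫ y, K (x - y) * ψ y) * f x = ∫ y, ψ y * ∫ x, K (y - x) * f x := by
  have h : Integrable (Function.uncurry fun y x : E d ↦ ψ y * (K (y - x) * f x))
      (volume.prod volume) := by
    obtain ⟨C, hC⟩ := ψ.decay 0 0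
    simp only [pow_zero, one_mul, norm_iteratedFDeriv_zero] at hC
    refine (((hf.convolution_integrand (ContinuousLinearMap.mul ℂ ℂ) hK).bdd_mul
      (c := C) (f := fun p : E d × E d ↦ ψ p.1) ?_
      (Eventually.of_forall fun p ↦ hC.2 p.1))).congr (Eventually.of_forall fun p ↦ ?_)
    · exact (ψ.continuous.comp continuous_fst).aestronglyMeasurable
    · simp [Function.uncurry, mul_comm]
  simp_rw [← integral_const_mul, ← integral_mul_const]
  rw [integral_integral_swap h]
  congr with x
  congr with y
  rw [← neg_sub x y, heven]
  ring

theorem ae_eq_zero_of_isVanishingOn {d : ℕ} {U : Set (E d)} (hU : IsOpen U)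
    (f : Lp ℂ 2 (volume : Measure (E d)))
    (hf : Distribution.IsVanishingOn (f : 𝓢'(E d, ℂ)) U) : ∀ᵐ x, x ∈ U → f x = 0 := by
  refine hU.ae_eq_zero_of_integral_contDiff_smul_eq_zero
    (((Lp.memLp f).locallyIntegrable (by norm_num)).locallyIntegrableOn U) ?_
  intro g hg₁ hg₂ hg₃
  have h₁ : HasCompactSupport (Complex.ofRealCLM ∘ g) := hg₂.comp_left rfl
  have h₂ : ContDiff ℝ ∞ (Complex.ofRealCLM ∘ g) := by fun_prop
  have h := hf (h₁.toSchwartzMap h₂) ((tsupport_comp_subset (g := Complex.ofRealCLM) (map_zero _) g).trans hg₃)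
  rw [Lp.toTemperedDistribution_apply] at h
  simpa using h

theorem integrable_of_ae_eq_zero_off_ball {d : ℕ} {r : ℝ} (f : Lp ℂ 2 (volume : Measure (E d)))
    (hf : ∀ᵐ y, y ∉ Metric.ball (0 : E d) r → f y = 0) : Integrable f := by
  have : IsFiniteMeasure (volume.restrict (Metric.ball (0 : E d) r)) :=
    ⟨by simpa using measure_ball_lt_top⟩
  have h : IntegrableOn f (Metric.ball (0 : E d) r) :=
    ((Lp.memLp f).restrict _).integrable (by norm_num)
  rw [← integrable_indicator_iff Metric.isOpen_ball.measurableSet] at h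
  refine h.congr ?_
  filter_upwards [hf] with y hy
  by_cases h : y ∈ Metric.ball (0 : E d) r
  · rw [indicator_of_mem h]
  · rw [indicator_of_notMem h, hy h]

/-- On a ball that contains both a neighbourhood of the given point and the support of `f`, the
potential equals a convolution of two `L¹` functions. The local kernel is chosen anew for each
point. -/
theorem locallyIntegrable_rieszPotential {d : ℕ} (hd : 1 ≤ d) {α : ℝ} (h₀ : 0 < α) (h₁ : α < 1)
    (h₂ : 2 * α < d) {f : E d → ℂ} (hfi : Integrable f) {r : ℝ}
    (hf : ∀ᵐ y, y ∉ Metric.ball (0 : E d) r → f y = 0) :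
    LocallyIntegrable (rieszPotential α f) := by
  intro x
  set r' : ℝ := max r (‖x‖ + 1) with hr'
  have hr₀ : 0 < r' := lt_max_of_lt_right (by positivity)
  obtain ⟨K, hKm, hKi, -, hK, -⟩ := exists_localKernel (d := d) h₀ h₁ h₂
    (R := 2 * r') (by positivity)
  have hKi : Integrable K := by
    rw [← integrable_norm_iff hKm]
    simpa using hKi 0
  have hf' : ∀ᵐ y, y ∉ Metric.ball (0 : E d) r' → f y = 0 := by
    filter_upwards [hf] with y hy h
    exact hy fun h' ↦ h (Metric.ball_subset_ball (le_max_left _ _) h')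
  refine ⟨Metric.ball 0 r', Metric.isOpen_ball.mem_nhds ?_, ?_⟩
  · rw [mem_ball_zero_iff]
    exact (lt_add_one _).trans_le (le_max_right _ _)
  · have hconv := hfi.integrable_convolution (ContinuousLinearMap.mul ℂ ℂ) hKi
    refine (hconv.integrableOn (s := Metric.ball 0 r')).congr ?_
    filter_upwards [ae_restrict_mem Metric.isOpen_ball.measurableSet] with y hy
    rw [rieszPotential_eq_localKernel hd hK hf' hy]
    simp only [convolution, ContinuousLinearMap.mul_apply', mul_comm]

/-- The Riesz potential maps `H̃^{s-2α}(Ω)` continuously to `H^s(Ω)`. -/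
theorem exists_rieszPotential_supported {d : ℕ} (hd : 1 ≤ d) {α : ℝ} (h₀ : 0 < α) (h₁ : α < 1)
    (h₂ : 2 * α < d) (s : ℝ) {Ω : Set (E d)} (hΩ : Bornology.IsBounded Ω) :
    ∃ T : SobolevSupported d (s - 2 * α) Ω →L[ℂ] SobolevOn d s Ω,
      ∀ u : SobolevSupported d (s - 2 * α) Ω,
        IsRieszPotential α u.1 (T u) ∧
        ∀ f : Lp ℂ 2 (volume : Measure (E d)), u.1.toDistribution = Lp.toTemperedDistribution f →
          IsGivenBy (T u) (rieszPotential α f) := by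
  obtain ⟨r, hr, hΩr⟩ := hΩ.closure.subset_ball_lt 0 0
  have hΩr' : Ω ⊆ Metric.ball 0 r := subset_closure.trans hΩr
  obtain ⟨K, hKm, hKn, heven, hK, C, hC⟩ := exists_localKernel (d := d) h₀ h₁ h₂
    (R := 2 * r) (by positivity)
  have hKi : Integrable K := by
    rw [← integrable_norm_iff hKm]
    simpa using hKn 0
  have hk : (𝓕 K).HasTemperateGrowth := hasTemperateGrowth_fourier hKm hKn
  obtain ⟨M, hM⟩ := exists_sobolev_fourierMultiplier hk (β := 2 * α) (C := C)
    (by simpa using hC) (sub_add_cancel s (2 * α))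
  have hpair : ∀ (u : SobolevSupported d (s - 2 * α) Ω) (ψ : 𝓢(E d, ℂ)) (hψ : tsupport ψ ⊆ Ω),
      SobolevOn.pairing ψ hψ ((vanishingOn d s Ω).mkQL (M u.1)) =
        u.1.toDistribution (𝓕 (SchwartzMap.smulLeftCLM ℂ (𝓕 K) (𝓕⁻ ψ))) := by
    intro u ψ hψ
    change (M u.1).toDistribution ψ = _
    rw [hM]
    rfl
  have hψ₀ : ∀ ψ : 𝓢(E d, ℂ), tsupport ψ ⊆ Ω →
      ∀ᵐ y, y ∉ Metric.ball (0 : E d) r → ψ y = 0 := fun ψ hψ ↦ Eventually.of_forall fun y hy ↦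
    image_eq_zero_of_notMem_tsupport fun h ↦ hy (hΩr' (hψ h))
  refine ⟨(vanishingOn d s Ω).mkQL ∘L M ∘L (vanishingOn d (s - 2 * α) (closure Ω)ᶜ).subtypeL,
    fun u ↦ ⟨fun ψ hψ g hg ↦ ?_, fun f hf ↦ ⟨?_, fun ψ hψ ↦ ?_⟩⟩⟩
  · refine (hpair u ψ hψ).trans ?_
    -- `K * ψ` and `g` both equal the Riesz potential of `ψ` on an open neighbourhood of the closure
    -- of `Ω`, so their difference is supported where `u` vanishes.
    rw [← sub_eq_zero, ← map_sub]
    refine u.2 _ ?_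
    obtain ⟨V, hV₁, hV₂, hV₃⟩ := eventually_nhdsSet_iff_exists.mp hg
    have hW : IsOpen (V ∩ Metric.ball (0 : E d) r) := hV₁.inter Metric.isOpen_ball
    have hsub : tsupport (𝓕 (SchwartzMap.smulLeftCLM ℂ (𝓕 K) (𝓕⁻ ψ)) - g : 𝓢(E d, ℂ)) ⊆
        (V ∩ Metric.ball (0 : E d) r)ᶜ := by
      refine closure_minimal (fun x hx hxV ↦ hx ?_) hW.isClosed_compl
      rw [_root_.sub_apply, fourier_smulLeftCLM_fourierInv_apply hKi heven hk, hV₃ x hxV.1,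
        rieszPotential_eq_localKernel hd hK (hψ₀ ψ hψ) hxV.2, sub_self]
    exact hsub.trans (compl_subset_compl.mpr (subset_inter hV₂ hΩr))
  all_goals
    have hf₀ : ∀ᵐ y, y ∉ Metric.ball (0 : E d) r → f y = 0 := by
      have h := ae_eq_zero_of_isVanishingOn isClosed_closure.isOpen_compl f 
        (by rw [← hf]; exact u.2)
      filter_upwards [h] with y hy hyr
      exact hy fun h ↦ hyr (hΩr h)
    have hfi := integrable_of_ae_eq_zero_off_ball f hf₀
  · exact locallyIntegrable_rieszPotential hd h₀ h₁ h₂ hfi hf₀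
  · refine (hpair u ψ hψ).trans ?_
    rw [hf, Lp.toTemperedDistribution_apply]
    simp_rw [fourier_smulLeftCLM_fourierInv_apply hKi heven hk, smul_eq_mul]
    rw [integral_mul_conv_comm hKi heven ψ hfi]
    congr with y
    by_cases hy : y ∈ Ω
    · rw [rieszPotential_eq_localKernel hd hK hf₀ (hΩr' hy)]
    · rw [image_eq_zero_of_notMem_tsupport fun h ↦ hy (hψ h), zero_mul, zero_mul]

open scoped ENNReal

/-! ### Increments of square integrable functions -/

theorem iteratedDeriv_cexp_ofReal (n : ℕ) (c : ℂ) :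
    iteratedDeriv n (fun s : ℝ ↦ Complex.exp (c * s)) = fun s : ℝ ↦ c ^ n * Complex.exp (c * s) := by
  induction n with
  | zero => simp
  | succ n ih =>
    rw [iteratedDeriv_succ, ih]
    ext s
    have h : HasDerivAt (fun s : ℝ ↦ Complex.exp (c * s)) (Complex.exp (c * s) * (c * 1)) s :=
      ((Complex.ofRealCLM.hasDerivAt (x := s)).const_mul c).cexp
    rw [(h.const_mul (c ^ n)).deriv]
    ring

theorem hasTemperateGrowth_cexp_I_mul {d : ℕ} (v : E d) :
    (fun ξ : E d ↦ Complex.exp (Complex.I * (inner ℝ ξ v : ℝ))).HasTemperateGrowth := by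
  have h : (fun s : ℝ ↦ Complex.exp (Complex.I * s)).HasTemperateGrowth := by
    refine ⟨(contDiff_const.mul Complex.ofRealCLM.contDiff).cexp, fun n ↦ ⟨0, 1, fun s ↦ ?_⟩⟩
    rw [norm_iteratedFDeriv_eq_norm_iteratedDeriv, iteratedDeriv_cexp_ofReal]
    simp [Complex.norm_exp]
  exact h.comp (Function.hasTemperateGrowth_inner_left v)

/-- Translation becomes modulation. For `L²` functions there need not be a Fourier integral, so the
identity is tested on Schwartz functions, where a modulation shifts `𝓕 ψ`. -/
theorem fourier_compMeasurePreserving_add {d : ℕ} (f : Lp ℂ 2 (volume : Measure (E d))) (v : E d) :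
    (𝓕 (Lp.compMeasurePreserving (· + v) (measurePreserving_add_right volume v) f) :
      Lp ℂ 2 (volume : Measure (E d))) =ᵐ[volume]
      fun ξ ↦ Complex.exp (Complex.I * (inner ℝ ξ ((2 * Real.pi) • v) : ℝ)) *
        (𝓕 f : Lp ℂ 2 (volume : Measure (E d))) ξ := by
  set χ : E d → ℂ := fun ξ ↦ Complex.exp (Complex.I * (inner ℝ ξ ((2 * Real.pi) • v) : ℝ))
    with hχ_def
  have hχ : χ.HasTemperateGrowth := hasTemperateGrowth_cexp_I_mul _
  have hχ' : MemLp χ ⊤ (volume : Measure (E d)) :=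
    memLp_top_of_bound hχ.1.continuous.aestronglyMeasurable 1
      (Eventually.of_forall fun ξ ↦ by simp [χ, Complex.norm_exp])
  have key : (𝓕 (Lp.compMeasurePreserving (· + v) (measurePreserving_add_right volume v) f) :
      Lp ℂ 2 (volume : Measure (E d))) = hχ'.toLp χ • (𝓕 f : Lp ℂ 2 (volume : Measure (E d))) := by
    apply SobolevSpace.lp_toDistribution_injective
    simp only [Lp.toTemperedDistributionCLM_apply]
    rw [Lp.toTemperedDistribution_smul_eq (r := 2) hχ hχ',
      ← Lp.fourier_toTemperedDistribution_eq, ← Lp.fourier_toTemperedDistribution_eq]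
    ext ψ
    rw [TemperedDistribution.fourier_apply, TemperedDistribution.smulLeftCLM_apply_apply,
      TemperedDistribution.fourier_apply, Lp.toTemperedDistribution_apply,
      Lp.toTemperedDistribution_apply]
    have h₁ : ∀ x, (𝓕 (SchwartzMap.smulLeftCLM ℂ χ ψ)) x = (𝓕 ψ) (x - v) := by
      intro x
      rw [SchwartzMap.fourier_coe, SchwartzMap.fourier_coe, Real.fourier_eq', Real.fourier_eq']
      congr with ξ
      rw [SchwartzMap.smulLeftCLM_apply_apply hχ, smul_smul, hχ_def, ← Complex.exp_add,
        inner_sub_right, inner_smul_right]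
      congr 2
      push_cast
      ring
    simp_rw [h₁]
    refine Eq.trans ?_ (integral_add_right_eq_self (fun x ↦ (𝓕 ψ) (x - v) • f x) v)
    refine integral_congr_ae ?_
    filter_upwards [Lp.coeFn_compMeasurePreserving f (measurePreserving_add_right volume v)]
      with x hx
    rw [hx, add_sub_cancel_right]
    rfl
  rw [key]
  filter_upwards [Lp.coeFn_lpSMul (r := 2) (hχ'.toLp χ) (𝓕 f : Lp ℂ 2 (volume : Measure (E d))),
    hχ'.coeFn_toLp] with ξ h₁ h₂
  rw [h₁, Pi.smul_apply', h₂, smul_eq_mul]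

theorem enorm_sq_eq_lintegral {d : ℕ} (f : Lp ℂ 2 (volume : Measure (E d))) :
    ‖f‖ₑ ^ 2 = ∫⁻ x, ‖f x‖ₑ ^ 2 := by
  have h := eLpNorm_nnreal_pow_eq_lintegral (p := 2) (f := f) (μ := volume) two_ne_zero
  rw [Lp.enorm_def]
  simpa using h

/-- The squared `L²` norm of the increment of `f` by the vector `v`. -/
def increment {d : ℕ} (f : E d → ℂ) (v : E d) : ℝ≥0∞ := ∫⁻ x, ‖f (x + v) - f x‖ₑ ^ 2

/-- Plancherel together with `|e^{2πi⟨ξ,v⟩} - 1|² = 4 sin²(π⟨ξ,v⟩)`. -/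
theorem increment_eq {d : ℕ} (f : Lp ℂ 2 (volume : Measure (E d))) (v : E d) :
    increment f v = ∫⁻ ξ, ENNReal.ofReal (4 * Real.sin (Real.pi * inner ℝ ξ v) ^ 2) *
      ‖(𝓕 f : Lp ℂ 2 (volume : Measure (E d))) ξ‖ₑ ^ 2 := by
  set τ : Lp ℂ 2 (volume : Measure (E d)) :=
    Lp.compMeasurePreserving (· + v) (measurePreserving_add_right volume v) f
  have h₁ : increment f v = ‖τ - f‖ₑ ^ 2 := by
    rw [enorm_sq_eq_lintegral]
    refine lintegral_congr_ae ?_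
    filter_upwards [Lp.coeFn_compMeasurePreserving f (measurePreserving_add_right volume v),
      Lp.coeFn_sub τ f] with x h₁ h₂
    rw [h₂, Pi.sub_apply, h₁]
    rfl
  have h₂ : ‖τ - f‖ₑ = ‖(𝓕 (τ - f) : Lp ℂ 2 (volume : Measure (E d)))‖ₑ := by
    rw [← ofReal_norm, ← ofReal_norm, Lp.norm_fourier_eq]
  rw [h₁, h₂, enorm_sq_eq_lintegral]
  refine lintegral_congr_ae ?_
  have h₃ : (𝓕 (τ - f) : Lp ℂ 2 (volume : Measure (E d))) = 𝓕 τ - 𝓕 f :=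
    map_sub (Lp.fourierTransformₗᵢ (E d) ℂ) τ f
  rw [h₃]
  filter_upwards [Lp.coeFn_sub (𝓕 τ : Lp ℂ 2 (volume : Measure (E d))) (𝓕 f),
    fourier_compMeasurePreserving_add f v] with ξ h₄ h₅
  rw [h₄, Pi.sub_apply, h₅, ← sub_one_mul, enorm_mul, mul_pow]
  congr 1
  rw [← ofReal_norm, ← ENNReal.ofReal_pow (norm_nonneg _),
    Complex.norm_exp_I_mul_ofReal_sub_one, Real.norm_eq_abs, sq_abs, inner_smul_right]
  congr 1
  rw [mul_pow]
  congr 3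
  · norm_num
  · ring

/-! ### Fractional energies -/

/-- The squared norm of `f` in `H^t`. -/
def sobolevEnergy {d : ℕ} (t : ℝ) (f : Lp ℂ 2 (volume : Measure (E d))) : ℝ≥0∞ :=
  ∫⁻ ξ, ENNReal.ofReal ((1 + ‖ξ‖ ^ 2) ^ t) *
    ‖(𝓕 f : Lp ℂ 2 (volume : Measure (E d))) ξ‖ₑ ^ 2

/-- The squared Gagliardo seminorm of order `t` in the direction `e`. -/
def directionalEnergy {d : ℕ} (t : ℝ) (f : E d → ℂ) (e : E d) : ℝ≥0∞ :=
  ∫⁻ h in Ioi (0 : ℝ), ENNReal.ofReal (h ^ (-1 - 2 * t)) * increment f (h • e)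

/-- The Fourier symbol of the directional energy. -/
def directionalSymbol (t η : ℝ) : ℝ≥0∞ :=
  ∫⁻ h in Ioi (0 : ℝ), ENNReal.ofReal (h ^ (-1 - 2 * t)) *
    ENNReal.ofReal (4 * Real.sin (Real.pi * (h * η)) ^ 2)

theorem directionalEnergy_eq {d : ℕ} (t : ℝ) (f : Lp ℂ 2 (volume : Measure (E d))) (e : E d) :
    directionalEnergy t f e = ∫⁻ ξ, directionalSymbol t (inner ℝ ξ e) *
      ‖(𝓕 f : Lp ℂ 2 (volume : Measure (E d))) ξ‖ₑ ^ 2 := by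
  have hF : Measurable (𝓕 f : Lp ℂ 2 (volume : Measure (E d))) :=
    (Lp.stronglyMeasurable _).measurable
  simp_rw [directionalEnergy, directionalSymbol, increment_eq]
  have h₁ : ∀ h : ℝ, ENNReal.ofReal (h ^ (-1 - 2 * t)) *
      ∫⁻ ξ, ENNReal.ofReal (4 * Real.sin (Real.pi * inner ℝ ξ (h • e)) ^ 2) *
        ‖(𝓕 f : Lp ℂ 2 (volume : Measure (E d))) ξ‖ₑ ^ 2 =
      ∫⁻ ξ, ENNReal.ofReal (h ^ (-1 - 2 * t)) *
        (ENNReal.ofReal (4 * Real.sin (Real.pi * inner ℝ ξ (h • e)) ^ 2) *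
        ‖(𝓕 f : Lp ℂ 2 (volume : Measure (E d))) ξ‖ₑ ^ 2) := fun h ↦
    (lintegral_const_mul _ (by fun_prop)).symm
  simp_rw [h₁]
  rw [lintegral_lintegral_swap]
  · refine lintegral_congr fun ξ ↦ ?_
    rw [← lintegral_mul_const _ (by fun_prop)]
    simp_rw [mul_assoc, inner_smul_right]
  · apply Measurable.aemeasurable
    unfold Function.uncurry
    fun_prop

/-- By scaling, the symbol is a constant multiple of `|η|^{2t}`. The constant is finite: near `h =
0` by `sin² y ≤ y²` and `t < 1`, at infinity by `sin² ≤ 1` and `t > 0`. The integral is split at `h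
= 1/|η|`. -/
theorem directionalSymbol_le {t : ℝ} (h₀ : 0 < t) (h₁ : t < 1) : ∃ C : ℝ≥0∞, C ≠ ⊤ ∧ ∀ η : ℝ,
    directionalSymbol t η ≤ C * ENNReal.ofReal (|η| ^ (2 * t)) := by
  refine ⟨ENNReal.ofReal (4 * Real.pi ^ 2 / (2 - 2 * t) + 4 / (2 * t)), ENNReal.ofReal_ne_top,
    fun η ↦ ?_⟩
  rcases eq_or_ne η 0 with rfl | hη
  · simp [directionalSymbol]
  have hη : 0 < |η| := abs_pos.mpr hη
  set b : ℝ := |η|⁻¹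
  have hb : 0 < b := inv_pos.mpr hη
  have hpi := Real.pi_pos
  have hA : ∫⁻ h in Ioc (0 : ℝ) b, ENNReal.ofReal (h ^ (-1 - 2 * t)) *
      ENNReal.ofReal (4 * Real.sin (Real.pi * (h * η)) ^ 2) ≤
      ENNReal.ofReal (4 * Real.pi ^ 2 / (2 - 2 * t) * |η| ^ (2 * t)) := by
    have hi : IntegrableOn (fun h : ℝ ↦ 4 * Real.pi ^ 2 * η ^ 2 * h ^ (1 - 2 * t)) (Ioc 0 b) := by
      rw [← intervalIntegrable_iff_integrableOn_Ioc_of_le hb.le]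
      exact (intervalIntegral.intervalIntegrable_rpow' (by linarith)).const_mul _
    calc _ ≤ ∫⁻ h in Ioc (0 : ℝ) b,
          ENNReal.ofReal (4 * Real.pi ^ 2 * η ^ 2 * h ^ (1 - 2 * t)) := by
          refine setLIntegral_mono' measurableSet_Ioc fun h hh ↦ ?_
          rw [← ENNReal.ofReal_mul (Real.rpow_nonneg hh.1.le _)]
          apply ENNReal.ofReal_le_ofReal
          have h₂ : Real.sin (Real.pi * (h * η)) ^ 2 ≤ (Real.pi * (h * η)) ^ 2 :=
            sq_le_sq.mpr Real.abs_sin_le_abs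
          have h₃ : h ^ (1 - 2 * t) = h ^ (-1 - 2 * t) * h ^ 2 := by
            rw [← Real.rpow_natCast, ← Real.rpow_add hh.1]
            congr 1
            push_cast
            ring
          have := Real.rpow_nonneg hh.1.le (-1 - 2 * t)
          rw [h₃]
          calc h ^ (-1 - 2 * t) * (4 * Real.sin (Real.pi * (h * η)) ^ 2)
              ≤ h ^ (-1 - 2 * t) * (4 * (Real.pi * (h * η)) ^ 2) := by gcongr
            _ = _ := by ring
      _ = ENNReal.ofReal (∫ h in Ioc (0 : ℝ) b, 4 * Real.pi ^ 2 * η ^ 2 * h ^ (1 - 2 * t)) := by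
          rw [ofReal_integral_eq_lintegral_ofReal hi]
          filter_upwards [ae_restrict_mem measurableSet_Ioc] with h hh
          have := Real.rpow_nonneg hh.1.le (1 - 2 * t)
          simp only [Pi.zero_apply]
          positivity
      _ = _ := by
          rw [integral_const_mul, ← intervalIntegral.integral_of_le hb.le,
            integral_rpow (Or.inl (by linarith)), Real.zero_rpow (by linarith), sub_zero,
            show 1 - 2 * t + 1 = 2 - 2 * t by ring, Real.inv_rpow hη.le, ← Real.rpow_neg hη.le,
            show -(2 - 2 * t) = 2 * t - (2 : ℕ) by push_cast; ring, Real.rpow_sub hη,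
            Real.rpow_natCast, sq_abs]
          congr 1
          have : η ^ 2 ≠ 0 := by rw [← sq_abs]; positivity
          field_simp
  have hB : ∫⁻ h in Ioi b, ENNReal.ofReal (h ^ (-1 - 2 * t)) *
      ENNReal.ofReal (4 * Real.sin (Real.pi * (h * η)) ^ 2) ≤
      ENNReal.ofReal (4 / (2 * t) * |η| ^ (2 * t)) := by
    have hi : IntegrableOn (fun h : ℝ ↦ 4 * h ^ (-1 - 2 * t)) (Ioi b) :=
      (integrableOn_Ioi_rpow_of_lt (by linarith) hb).const_mul _
    calc _ ≤ ∫⁻ h in Ioi b, ENNReal.ofReal (4 * h ^ (-1 - 2 * t)) := by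
          refine setLIntegral_mono' measurableSet_Ioi fun h hh ↦ ?_
          have hh₀ : 0 < h := hb.trans hh
          rw [← ENNReal.ofReal_mul (Real.rpow_nonneg hh₀.le _)]
          apply ENNReal.ofReal_le_ofReal
          have := Real.rpow_nonneg hh₀.le (-1 - 2 * t)
          nlinarith [Real.sin_sq_le_one (Real.pi * (h * η))]
      _ = ENNReal.ofReal (∫ h in Ioi b, 4 * h ^ (-1 - 2 * t)) := by
          rw [ofReal_integral_eq_lintegral_ofReal hi]
          filter_upwards [ae_restrict_mem measurableSet_Ioi] with h hh
          have := Real.rpow_nonneg (hb.trans hh).le (-1 - 2 * t)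
          simp only [Pi.zero_apply]
          positivity
      _ = _ := by
          rw [integral_const_mul, integral_Ioi_rpow_of_lt (by linarith) hb,
            show -1 - 2 * t + 1 = -(2 * t) by ring, Real.inv_rpow hη.le, Real.rpow_neg hη.le,
            inv_inv]
          congr 1
          field_simp
  have := Real.rpow_nonneg hη.le (2 * t)
  have hp₁ : 0 ≤ 4 * Real.pi ^ 2 / (2 - 2 * t) := div_nonneg (by positivity) (by linarith)
  rw [directionalSymbol, ← Ioc_union_Ioi_eq_Ioi hb.le,
    lintegral_union measurableSet_Ioi (Ioc_disjoint_Ioi le_rfl), ← ENNReal.ofReal_mul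
    (by positivity), add_mul, ENNReal.ofReal_add (by positivity) (by positivity)]
  exact add_le_add hA hB

/-- The range `1/4 < h|η| ≤ 1/2`, on which the squared sine is at least `1/2`, already contributes
`(2|η|)^{2t}`. -/
theorem le_directionalSymbol {t : ℝ} (h₀ : 0 < t) : ∃ C : ℝ≥0∞, C ≠ ⊤ ∧ ∀ η : ℝ,
    ENNReal.ofReal (|η| ^ (2 * t)) ≤ C * directionalSymbol t η := by
  refine ⟨2, by simp, fun η ↦ ?_⟩
  rcases eq_or_ne η 0 with rfl | hη
  · simp [Real.zero_rpow (by linarith : 2 * t ≠ 0)]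
  have hη : 0 < |η| := abs_pos.mpr hη
  have hpi := Real.pi_pos
  have hsin : ∀ h ∈ Ioc (1 / (4 * |η|)) (1 / (2 * |η|)),
      1 / 2 ≤ Real.sin (Real.pi * (h * η)) ^ 2 := by
    intro h hh
    have hh₀ : 0 < h := lt_trans (by positivity) hh.1
    have e₁ : 1 / 4 ≤ h * |η| := by
      have := hh.1
      rw [div_lt_iff₀ (by positivity)] at this
      linarith
    have e₂ : h * |η| ≤ 1 / 2 := by
      have := hh.2
      rw [le_div_iff₀ (by positivity)] at this
      linarith
    have e₃ : Real.sin (Real.pi * (h * η)) ^ 2 = Real.sin (Real.pi * (h * |η|)) ^ 2 := by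
      rcases abs_choice η with h' | h' <;> rw [h']
      rw [mul_neg, mul_neg, Real.sin_neg, neg_sq]
    have e₄ : Real.sin (Real.pi / 4) ≤ Real.sin (Real.pi * (h * |η|)) := by
      apply Real.sin_le_sin_of_le_of_le_pi_div_two <;> nlinarith
    rw [e₃]
    have e₅ : Real.sin (Real.pi / 4) ^ 2 = 1 / 2 := by
      rw [Real.sin_pi_div_four, div_pow, Real.sq_sqrt (by norm_num)]
      norm_num
    rw [← e₅]
    have : 0 ≤ Real.sin (Real.pi / 4) := by rw [Real.sin_pi_div_four]; positivity
    gcongr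
  have hlow : ∀ h ∈ Ioc (1 / (4 * |η|)) (1 / (2 * |η|)),
      ENNReal.ofReal ((1 / (2 * |η|)) ^ (-1 - 2 * t) * 2) ≤ ENNReal.ofReal (h ^ (-1 - 2 * t)) *
        ENNReal.ofReal (4 * Real.sin (Real.pi * (h * η)) ^ 2) := by
    intro h hh
    have hh₀ : 0 < h := lt_trans (by positivity) hh.1
    rw [← ENNReal.ofReal_mul (Real.rpow_nonneg hh₀.le _)]
    apply ENNReal.ofReal_le_ofReal
    have h₂ : (1 / (2 * |η|)) ^ (-1 - 2 * t) ≤ h ^ (-1 - 2 * t) :=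
      Real.rpow_le_rpow_of_nonpos hh₀ hh.2 (by linarith)
    have h₃ := hsin h hh
    have := Real.rpow_nonneg hh₀.le (-1 - 2 * t)
    gcongr
    linarith
  have hint : ENNReal.ofReal ((1 / (2 * |η|)) ^ (-1 - 2 * t) * 2) *
      volume (Ioc (1 / (4 * |η|)) (1 / (2 * |η|))) ≤ directionalSymbol t η := by
    rw [← setLIntegral_const]
    refine (setLIntegral_mono' measurableSet_Ioc hlow).trans (lintegral_mono_set ?_)
    exact fun h hh ↦ lt_trans (by positivity) hh.1
  refine le_trans ?_ (mul_le_mul_right hint 2)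
  rw [Real.volume_Ioc, ← ENNReal.ofReal_mul (by positivity),
    show (2 : ℝ≥0∞) = ENNReal.ofReal 2 by simp, ← ENNReal.ofReal_mul (by norm_num)]
  apply ENNReal.ofReal_le_ofReal
  have h₂ : (1 / (2 * |η|)) ^ (-1 - 2 * t) = (2 * |η|) * (2 * |η|) ^ (2 * t) := by
    rw [one_div, Real.inv_rpow (by positivity), ← Real.rpow_neg (by positivity),
      show -(-1 - 2 * t) = 1 + 2 * t by ring, Real.rpow_add (by positivity), Real.rpow_one]
  have h₃ : |η| ^ (2 * t) ≤ (2 * |η|) ^ (2 * t) := by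
    gcongr
    linarith
  rw [h₂]
  have h₄ : 2 * (2 * |η| * (2 * |η|) ^ (2 * t) * 2 * (1 / (2 * |η|) - 1 / (4 * |η|))) =
      2 * (2 * |η|) ^ (2 * t) := by
    field_simp
    ring
  rw [h₄]
  have := Real.rpow_nonneg hη.le (2 * t)
  linarith

theorem lintegral_le_sobolevEnergy {d : ℕ} {t : ℝ} (h₀ : 0 ≤ t)
    (f : Lp ℂ 2 (volume : Measure (E d))) : ∫⁻ x, ‖f x‖ₑ ^ 2 ≤ sobolevEnergy t f := by
  have h : ‖f‖ₑ = ‖(𝓕 f : Lp ℂ 2 (volume : Measure (E d)))‖ₑ := by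
    rw [← ofReal_norm, ← ofReal_norm, Lp.norm_fourier_eq]
  rw [← enorm_sq_eq_lintegral, h, enorm_sq_eq_lintegral]
  refine lintegral_mono fun ξ ↦ le_mul_of_one_le_left (zero_le) ?_
  rw [← ENNReal.ofReal_one]
  exact ENNReal.ofReal_le_ofReal (Real.one_le_rpow (by nlinarith [sq_nonneg ‖ξ‖]) h₀)

theorem directionalEnergy_le {d : ℕ} {t : ℝ} (h₀ : 0 < t) (h₁ : t < 1) : ∃ C : ℝ≥0∞, C ≠ ⊤ ∧
    ∀ (e : E d), ‖e‖ = 1 → ∀ f : Lp ℂ 2 (volume : Measure (E d)),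
      directionalEnergy t f e ≤ C * sobolevEnergy t f := by
  obtain ⟨C, hC, h⟩ := directionalSymbol_le h₀ h₁
  refine ⟨C, hC, fun e he f ↦ ?_⟩
  rw [directionalEnergy_eq, sobolevEnergy, ← lintegral_const_mul' _ _ hC]
  refine lintegral_mono fun ξ ↦ ?_
  simp only
  rw [← mul_assoc]
  gcongr
  refine (h _).trans ?_
  gcongr
  have h₂ : |inner ℝ ξ e| ≤ ‖ξ‖ := by simpa [he] using abs_real_inner_le_norm ξ e
  calc |inner ℝ ξ e| ^ (2 * t) ≤ ‖ξ‖ ^ (2 * t) := by gcongr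
    _ = (‖ξ‖ ^ 2) ^ t := by rw [Real.rpow_mul (norm_nonneg _), Real.rpow_two]
    _ ≤ (1 + ‖ξ‖ ^ 2) ^ t := by gcongr; linarith

/-- Subadditivity of `x^t` for `t ≤ 1`. Applied to the squares `ξ_i²`, it reduces the `H^t` norm to
finitely many directions. -/
theorem one_add_sum_rpow_le {ι : Type*} (s : Finset ι) (a : ι → ℝ) (ha : ∀ i, 0 ≤ a i) {t : ℝ}
    (h₀ : 0 ≤ t) (h₁ : t ≤ 1) : (1 + ∑ i ∈ s, a i) ^ t ≤ 1 + ∑ i ∈ s, a i ^ t := by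
  classical
  induction s using Finset.induction_on with
  | empty => simp
  | insert i s hi ih =>
    rw [Finset.sum_insert hi, Finset.sum_insert hi, add_left_comm, add_left_comm 1]
    refine (Real.rpow_add_le_add_rpow (ha i)
      (add_nonneg zero_le_one (Finset.sum_nonneg fun j _ ↦ ha j)) h₀ h₁).trans ?_
    gcongr

/-- The norm of `H^t` is controlled by the Gagliardo seminorms in the coordinate directions. -/
theorem sobolevEnergy_le {d : ℕ} {t : ℝ} (h₀ : 0 < t) (h₁ : t < 1) : ∃ C : ℝ≥0∞, C ≠ ⊤ ∧
    ∀ f : Lp ℂ 2 (volume : Measure (E d)), sobolevEnergy t f ≤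
      (∫⁻ x, ‖f x‖ₑ ^ 2) +
        C * ∑ i : Fin d, directionalEnergy t f (EuclideanSpace.single i (1 : ℝ)) := by
  obtain ⟨C, hC, h⟩ := le_directionalSymbol h₀
  refine ⟨C, hC, fun f ↦ ?_⟩
  have hF : Measurable (𝓕 f : Lp ℂ 2 (volume : Measure (E d))) :=
    (Lp.stronglyMeasurable _).measurable
  have hnorm : ‖f‖ₑ = ‖(𝓕 f : Lp ℂ 2 (volume : Measure (E d)))‖ₑ := by
    rw [← ofReal_norm, ← ofReal_norm, Lp.norm_fourier_eq]
  have hpt : ∀ ξ : E d, ENNReal.ofReal ((1 + ‖ξ‖ ^ 2) ^ t) ≤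
      1 + ∑ i : Fin d, C * directionalSymbol t (inner ℝ ξ (EuclideanSpace.single i (1 : ℝ))) := by
    intro ξ
    have h₂ : (1 + ‖ξ‖ ^ 2) ^ t ≤ 1 + ∑ i : Fin d, |ξ i| ^ (2 * t) := by
      rw [EuclideanSpace.norm_sq_eq]
      refine (one_add_sum_rpow_le _ _ (fun i ↦ sq_nonneg _) h₀.le h₁.le).trans_eq ?_
      congr with i
      rw [Real.rpow_mul (abs_nonneg _), Real.rpow_two, Real.norm_eq_abs]
    refine (ENNReal.ofReal_le_ofReal h₂).trans ?_
    rw [ENNReal.ofReal_add zero_le_one (Finset.sum_nonneg fun i _ ↦ by positivity),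
      ENNReal.ofReal_one, ENNReal.ofReal_sum_of_nonneg fun i _ ↦ by positivity]
    gcongr with i
    have h₃ : inner ℝ ξ (EuclideanSpace.single i (1 : ℝ)) = ξ i := by
      simp [EuclideanSpace.inner_single_right]
    rw [h₃]
    exact h (ξ i)
  have hsm : Measurable (directionalSymbol t) := by
    unfold directionalSymbol
    refine Measurable.lintegral_prod_right'
      (f := fun p : ℝ × ℝ ↦ ENNReal.ofReal (p.2 ^ (-1 - 2 * t)) *
        ENNReal.ofReal (4 * Real.sin (Real.pi * (p.2 * p.1)) ^ 2)) ?_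
    fun_prop
  rw [← enorm_sq_eq_lintegral, hnorm, enorm_sq_eq_lintegral, sobolevEnergy]
  calc _ ≤ ∫⁻ ξ, (‖(𝓕 f : Lp ℂ 2 (volume : Measure (E d))) ξ‖ₑ ^ 2 +
        ∑ i : Fin d, C * (directionalSymbol t (inner ℝ ξ (EuclideanSpace.single i (1 : ℝ))) *
          ‖(𝓕 f : Lp ℂ 2 (volume : Measure (E d))) ξ‖ₑ ^ 2)) := by
        refine lintegral_mono fun ξ ↦ ?_
        refine (mul_le_mul_left (hpt ξ) _).trans_eq ?_
        rw [add_mul, one_mul, Finset.sum_mul]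
        simp_rw [mul_assoc]
    _ = _ := by
        rw [lintegral_add_left (by fun_prop), lintegral_finsetSum]
        · rw [Finset.mul_sum]
          simp_rw [directionalEnergy_eq]
          congr 2 with i
          rw [lintegral_const_mul' _ _ hC]
        · intro i _
          have := hsm.comp (by fun_prop :
            Measurable fun ξ : E d ↦ inner ℝ ξ (EuclideanSpace.single i (1 : ℝ)))
          exact (this.mul (by fun_prop)).const_mul C

/-! ### A fractional Hardy inequality -/

theorem enorm_sq_le_two_mul {E' : Type*} [SeminormedAddCommGroup E'] (a b : E') :
    ‖a‖ₑ ^ 2 ≤ 2 * ‖b‖ₑ ^ 2 + 2 * ‖b - a‖ₑ ^ 2 := by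
  simp_rw [← ofReal_norm]
  rw [← ENNReal.ofReal_pow (norm_nonneg _), ← ENNReal.ofReal_pow (norm_nonneg _),
    ← ENNReal.ofReal_pow (norm_nonneg _), show (2 : ℝ≥0∞) = ENNReal.ofReal 2 by simp,
    ← ENNReal.ofReal_mul zero_le_two, ← ENNReal.ofReal_mul zero_le_two,
    ← ENNReal.ofReal_add (by positivity) (by positivity)]
  apply ENNReal.ofReal_le_ofReal
  have h : ‖a‖ ≤ ‖b‖ + ‖b - a‖ := by
    have := norm_sub_le b (b - a)
    rwa [sub_sub_cancel] at this
  nlinarith [sq_nonneg (‖b‖ - ‖b - a‖), norm_nonneg a]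

/-- The averaging kernel of the Hardy inequality: for fixed `ρ > ε` it has support in
`[cρ, 2cρ]` and integral `ρ^{-2t}`. -/
def hardyKernel (t c ε ρ h : ℝ) : ℝ≥0∞ :=
  {p : ℝ × ℝ | ε < p.1 ∧ c * p.1 ≤ p.2 ∧ p.2 ≤ 2 * c * p.1}.indicator
    (fun p ↦ ENNReal.ofReal (p.1 ^ (-1 - 2 * t) / c)) (ρ, h)

theorem measurable_hardyKernel (t c ε : ℝ) :
    Measurable fun p : ℝ × ℝ ↦ hardyKernel t c ε p.1 p.2 := by
  unfold hardyKernel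
  refine Measurable.indicator (by fun_prop) ?_
  refine (measurableSet_lt measurable_const measurable_fst).inter ?_
  exact (measurableSet_le (measurable_fst.const_mul c) measurable_snd).inter
    (measurableSet_le measurable_snd (measurable_fst.const_mul (2 * c)))

theorem lintegral_hardyKernel {t c ε ρ : ℝ} (hc : 0 < c) (hε : 0 < ε) (hρ : ε < ρ) :
    ENNReal.ofReal (ρ ^ (-(2 * t))) ≤ ∫⁻ h, hardyKernel t c ε ρ h := by
  have hρ₀ : 0 < ρ := hε.trans hρ
  have h₁ : ∀ h ∈ Icc (c * ρ) (2 * c * ρ),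
      ENNReal.ofReal (ρ ^ (-1 - 2 * t) / c) ≤ hardyKernel t c ε ρ h := by
    intro h hh
    rw [hardyKernel, indicator_of_mem]
    exact ⟨hρ, hh.1, hh.2⟩
  calc ENNReal.ofReal (ρ ^ (-(2 * t)))
      = ENNReal.ofReal (ρ ^ (-1 - 2 * t) / c) * volume (Icc (c * ρ) (2 * c * ρ)) := by
        rw [Real.volume_Icc, ← ENNReal.ofReal_mul (by positivity)]
        congr 1
        rw [show -(2 * t) = (-1 - 2 * t) + 1 by ring, Real.rpow_add hρ₀, Real.rpow_one]
        field_simp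
        ring
    _ = ∫⁻ _ in Icc (c * ρ) (2 * c * ρ), ENNReal.ofReal (ρ ^ (-1 - 2 * t) / c) := by
        rw [setLIntegral_const]
    _ ≤ ∫⁻ h in Icc (c * ρ) (2 * c * ρ), hardyKernel t c ε ρ h :=
        setLIntegral_mono' measurableSet_Icc h₁
    _ ≤ _ := setLIntegral_le_lintegral _ _

/-- A point at height `R` is reached by steps `h` from heights `R - h ≥ R/(1+2c)`, and these `h`
fill an interval of length `cR/((1+c)(1+2c))`. The resulting factor `(1+2c)^{2t}/(1+c)` tends to `0`
as `c → ∞` because `2t < 1`; this smallness drives the Hardy inequality. -/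
theorem lintegral_hardyKernel_sub_le {t c ε : ℝ} (ht : 0 < t) (hc : 0 < c) (hε : 0 < ε) (R : ℝ) :
    ∫⁻ h, hardyKernel t c ε (R - h) h ≤
      (Ioi ε).indicator (fun R ↦ ENNReal.ofReal ((1 + 2 * c) ^ (2 * t) / (1 + c)) *
        ENNReal.ofReal (R ^ (-(2 * t)))) R := by
  by_cases hR : ε < R
  · have hR₀ : 0 < R := hε.trans hR
    rw [indicator_of_mem (mem_Ioi.mpr hR)]
    have h₁ : ∀ h, hardyKernel t c ε (R - h) h ≤
        (Icc (c * R / (1 + c)) (2 * c * R / (1 + 2 * c))).indicator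
          (fun _ ↦ ENNReal.ofReal ((R / (1 + 2 * c)) ^ (-1 - 2 * t) / c)) h := by
      intro h
      by_cases hh : (R - h, h) ∈ {p : ℝ × ℝ | ε < p.1 ∧ c * p.1 ≤ p.2 ∧ p.2 ≤ 2 * c * p.1}
      · rw [hardyKernel, indicator_of_mem hh, indicator_of_mem]
        · obtain ⟨e₁, e₂, e₃⟩ := hh
          simp only at e₁ e₂ e₃ ⊢
          apply ENNReal.ofReal_le_ofReal
          gcongr ?_ / c
          apply Real.rpow_le_rpow_of_nonpos (by positivity) _ (by linarith)
          rw [div_le_iff₀ (by positivity)]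
          nlinarith
        · obtain ⟨e₁, e₂, e₃⟩ := hh
          simp only at e₁ e₂ e₃
          constructor
          · rw [div_le_iff₀ (by positivity)]
            nlinarith
          · rw [le_div_iff₀ (by positivity)]
            nlinarith
      · rw [hardyKernel, indicator_of_notMem hh]
        exact zero_le
    refine (lintegral_mono h₁).trans_eq ?_
    rw [lintegral_indicator measurableSet_Icc, setLIntegral_const, Real.volume_Icc,
      ← ENNReal.ofReal_mul (by positivity), ← ENNReal.ofReal_mul (by positivity)]
    congr 1
    have h₂ : (R / (1 + 2 * c)) ^ (-1 - 2 * t) =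
        R ^ (-(2 * t)) * R⁻¹ * ((1 + 2 * c) * (1 + 2 * c) ^ (2 * t)) := by
      rw [Real.div_rpow hR₀.le (by positivity), show -1 - 2 * t = -(2 * t) + -1 by ring,
        Real.rpow_add hR₀, Real.rpow_neg_one, div_eq_mul_inv, ← Real.rpow_neg (by positivity),
        show -(-(2 * t) + -1) = 1 + 2 * t by ring, Real.rpow_add (by positivity), Real.rpow_one]
    rw [h₂]
    field_simp
    ring
  · rw [indicator_of_notMem (by simpa using hR), nonpos_iff_eq_zero]
    rw [lintegral_eq_zero_iff']
    · refine Eventually.of_forall fun h ↦ ?_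
      change hardyKernel t c ε (R - h) h = 0
      rw [hardyKernel, indicator_of_notMem]
      · rintro ⟨e₁, e₂, -⟩
        simp only at e₁ e₂
        have : 0 < c * (R - h) := mul_pos hc (hε.trans e₁)
        exact hR (by linarith)
    · exact ((measurable_hardyKernel t c ε).comp
        (by fun_prop : Measurable fun h : ℝ ↦ (R - h, h))).aemeasurable

/-- On the support `ρ ≥ h/(2c)`, so the kernel is dominated, uniformly in `ρ`, by the weight of the
directional energy. -/
theorem hardyKernel_le {t c ε ρ h : ℝ} (ht : 0 < t) (hc : 0 < c) (hε : 0 < ε) :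
    hardyKernel t c ε ρ h ≤ (Ioi 0).indicator
      (fun h ↦ ENNReal.ofReal ((2 * c) ^ (1 + 2 * t) / c) *
        ENNReal.ofReal (h ^ (-1 - 2 * t))) h := by
  by_cases hh : (ρ, h) ∈ {p : ℝ × ℝ | ε < p.1 ∧ c * p.1 ≤ p.2 ∧ p.2 ≤ 2 * c * p.1}
  · rw [hardyKernel, indicator_of_mem hh]
    obtain ⟨e₁, e₂, e₃⟩ := hh
    simp only at e₁ e₂ e₃ ⊢
    have hρ : 0 < ρ := hε.trans e₁
    have hh₀ : 0 < h := (mul_pos hc hρ).trans_le e₂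
    rw [indicator_of_mem (by exact hh₀), ← ENNReal.ofReal_mul (by positivity)]
    apply ENNReal.ofReal_le_ofReal
    rw [div_mul_eq_mul_div]
    gcongr ?_ / c
    have h₂ : (2 * c) ^ (1 + 2 * t) * h ^ (-1 - 2 * t) = (h / (2 * c)) ^ (-1 - 2 * t) := by
      rw [Real.div_rpow hh₀.le (by positivity), div_eq_mul_inv, ← Real.rpow_neg (by positivity),
        mul_comm]
      congr 2
      ring
    rw [h₂]
    apply Real.rpow_le_rpow_of_nonpos (by positivity) _ (by linarith)
    rw [div_le_iff₀ (by positivity)]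
    linarith
  · rw [hardyKernel, indicator_of_notMem hh]
    exact zero_le

/-- The fractional Hardy inequality of order `t < 1/2` in the direction `ν`, for the distance to
the graph `{r = 0}` that is measured along `ν`. -/
theorem hardy_inequality {t : ℝ} (h₀ : 0 < t) (h₁ : t < 1 / 2) : ∃ C : ℝ≥0∞, C ≠ ⊤ ∧
    ∀ {d : ℕ} (ν : E d) (r : E d → ℝ), Measurable r → (∀ x (h : ℝ), r (x + h • ν) = r x + h) →
      ∀ f : E d → ℂ, Measurable f → ∫⁻ x, ‖f x‖ₑ ^ 2 ≠ ⊤ →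
        ∫⁻ x in {x | 0 < r x}, ENNReal.ofReal (r x ^ (-(2 * t))) * ‖f x‖ₑ ^ 2 ≤
          C * directionalEnergy t f ν := by
  obtain ⟨c, hc, hcκ⟩ : ∃ c : ℝ, 0 < c ∧ (1 + 2 * c) ^ (2 * t) / (1 + c) ≤ 1 / 4 := by
    -- With `c = N - 1` and `N^{1-2t} = 8`, the factor is at most `(2N)^{2t}/N ≤ 2N^{2t-1} = 1/4`.
    set N : ℝ := 8 ^ (1 / (1 - 2 * t)) with hN
    have hN₁ : 1 < N := Real.one_lt_rpow (by norm_num) (by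
      apply div_pos one_pos; linarith)
    have hN₂ : N ^ (1 - 2 * t) = 8 := by
      rw [hN, ← Real.rpow_mul (by norm_num), one_div_mul_cancel (by linarith), Real.rpow_one]
    refine ⟨N - 1, by linarith, ?_⟩
    rw [div_le_iff₀ (by linarith)]
    have e₁ : (1 + 2 * (N - 1)) ^ (2 * t) ≤ (2 * N) ^ (2 * t) :=
      Real.rpow_le_rpow (by linarith) (by linarith) (by linarith)
    have e₂ : (2 * N) ^ (2 * t) = 2 ^ (2 * t) * N ^ (2 * t) :=
      Real.mul_rpow (by norm_num) (by linarith)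
    have e₃ : (2 : ℝ) ^ (2 * t) ≤ 2 ^ (1 : ℝ) :=
      Real.rpow_le_rpow_of_exponent_le (by norm_num) (by linarith)
    have e₄ : N = 8 * N ^ (2 * t) := by
      rw [← hN₂, ← Real.rpow_add (by linarith)]
      simp
    have e₅ : 0 < N ^ (2 * t) := by positivity
    rw [Real.rpow_one] at e₃
    have e₆ : (2 : ℝ) ^ (2 * t) * N ^ (2 * t) ≤ 2 * N ^ (2 * t) := by gcongr
    linarith
  set κ : ℝ≥0∞ := ENNReal.ofReal ((2 * c) ^ (1 + 2 * t) / c) with hκ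
  refine ⟨2 * (2 * κ), ENNReal.mul_ne_top (by simp)
    (ENNReal.mul_ne_top (by simp) ENNReal.ofReal_ne_top), ?_⟩
  intro d ν r hr hrν f hf hf₂
  have hk := measurable_hardyKernel t c
  -- Away from the graph the weight is bounded, so the truncated integral is finite and a part of it
  -- can be absorbed. The constant does not depend on `ε`.
  have trunc : ∀ ε : ℝ, 0 < ε →
      ∫⁻ x in {x | ε < r x}, ENNReal.ofReal (r x ^ (-(2 * t))) * ‖f x‖ₑ ^ 2 ≤
        2 * (2 * κ) * directionalEnergy t f ν := by
    intro ε hε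
    have hS : MeasurableSet {x | ε < r x} := measurableSet_lt measurable_const hr
    set I := ∫⁻ x in {x | ε < r x}, ENNReal.ofReal (r x ^ (-(2 * t))) * ‖f x‖ₑ ^ 2 with hI
    have hIfin : I ≠ ⊤ := by
      have : I ≤ ENNReal.ofReal (ε ^ (-(2 * t))) * ∫⁻ x, ‖f x‖ₑ ^ 2 := by
        rw [← lintegral_const_mul' _ _ ENNReal.ofReal_ne_top]
        refine le_trans (setLIntegral_mono' hS fun x hx ↦ ?_) (setLIntegral_le_lintegral _ _)
        have hx : ε < r x := hx
        gcongr ENNReal.ofReal ?_ * _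
        exact Real.rpow_le_rpow_of_nonpos hε hx.le (by linarith)
      exact ne_top_of_le_ne_top (ENNReal.mul_ne_top ENNReal.ofReal_ne_top hf₂) this
    have hkx : Measurable fun p : E d × ℝ ↦ hardyKernel t c ε (r p.1) p.2 :=
      (hk ε).comp (by fun_prop : Measurable fun p : E d × ℝ ↦ (r p.1, p.2))
    have hshift : Measurable fun p : E d × ℝ ↦ f (p.1 + p.2 • ν) := by fun_prop
    set A := ∫⁻ x, ∫⁻ h, hardyKernel t c ε (r x) h * ‖f (x + h • ν)‖ₑ ^ 2 with hA
    set B := ∫⁻ x, ∫⁻ h, hardyKernel t c ε (r x) h * ‖f (x + h • ν) - f x‖ₑ ^ 2 with hB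
    -- `|f(x)|²` is compared with `|f(x + hν)|²`, averaged over `h` with the kernel: `A` collects
    -- the shifted values and `B` the increments.
    have hIAB : I ≤ 2 * A + 2 * B := by
      calc I ≤ ∫⁻ x in {x | ε < r x}, ∫⁻ h, hardyKernel t c ε (r x) h * ‖f x‖ₑ ^ 2 := by
            refine setLIntegral_mono' hS fun x hx ↦ ?_
            have m₁ : Measurable fun h : ℝ ↦ hardyKernel t c ε (r x) h :=
              hkx.comp measurable_prodMk_left
            rw [lintegral_mul_const _ m₁]
            gcongr
            exact lintegral_hardyKernel hc hε hx
        _ ≤ ∫⁻ x, ∫⁻ h, hardyKernel t c ε (r x) h * ‖f x‖ₑ ^ 2 := setLIntegral_le_lintegral _ _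
        _ ≤ ∫⁻ x, ∫⁻ h, (2 * (hardyKernel t c ε (r x) h * ‖f (x + h • ν)‖ₑ ^ 2) +
              2 * (hardyKernel t c ε (r x) h * ‖f (x + h • ν) - f x‖ₑ ^ 2)) := by
            refine lintegral_mono fun x ↦ lintegral_mono fun h ↦ ?_
            refine (mul_le_mul_right (enorm_sq_le_two_mul (f x) (f (x + h • ν))) _).trans_eq ?_
            ring
        _ = ∫⁻ x, ((2 * ∫⁻ h, hardyKernel t c ε (r x) h * ‖f (x + h • ν)‖ₑ ^ 2) +
              2 * ∫⁻ h, hardyKernel t c ε (r x) h * ‖f (x + h • ν) - f x‖ₑ ^ 2) := by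
            refine lintegral_congr fun x ↦ ?_
            have m₁ : Measurable fun h : ℝ ↦ hardyKernel t c ε (r x) h :=
              hkx.comp measurable_prodMk_left
            rw [lintegral_add_left (by fun_prop), lintegral_const_mul' _ _ (by simp),
              lintegral_const_mul' _ _ (by simp)]
        _ = 2 * A + 2 * B := by
            rw [lintegral_add_left, lintegral_const_mul' _ _ (by simp),
              lintegral_const_mul' _ _ (by simp)]
            refine Measurable.const_mul ?_ _
            exact Measurable.lintegral_prod_right'
              (f := fun p : E d × ℝ ↦ hardyKernel t c ε (r p.1) p.2 * ‖f (p.1 + p.2 • ν)‖ₑ ^ 2)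
              (by fun_prop)
    -- The substitution `y = x + hν` raises `r` by `h`, so the averaged weight at `y` is at most a
    -- quarter of the original one.
    have hAI : A ≤ ENNReal.ofReal (1 / 4) * I := by
      calc A = ∫⁻ h, ∫⁻ x, hardyKernel t c ε (r x) h * ‖f (x + h • ν)‖ₑ ^ 2 := by
            refine lintegral_lintegral_swap (Measurable.aemeasurable ?_)
            unfold Function.uncurry
            fun_prop
        _ = ∫⁻ h, ∫⁻ y, hardyKernel t c ε (r y - h) h * ‖f y‖ₑ ^ 2 := by
            refine lintegral_congr fun h ↦ ?_
            rw [← lintegral_add_right_eq_self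
              (fun y ↦ hardyKernel t c ε (r y - h) h * ‖f y‖ₑ ^ 2) (h • ν)]
            refine lintegral_congr fun x ↦ ?_
            rw [hrν, add_sub_cancel_right]
        _ = ∫⁻ y, (∫⁻ h, hardyKernel t c ε (r y - h) h) * ‖f y‖ₑ ^ 2 := by
            have m₁ : Measurable fun p : ℝ × E d ↦ hardyKernel t c ε (r p.2 - p.1) p.1 :=
              (hk ε).comp (by fun_prop : Measurable fun p : ℝ × E d ↦ (r p.2 - p.1, p.1))
            rw [lintegral_lintegral_swap]
            · refine lintegral_congr fun y ↦ ?_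
              have m₂ : Measurable fun h : ℝ ↦ hardyKernel t c ε (r y - h) h :=
                m₁.comp measurable_prodMk_right
              rw [lintegral_mul_const _ m₂]
            · apply Measurable.aemeasurable
              unfold Function.uncurry
              fun_prop
        _ ≤ ∫⁻ y, {x | ε < r x}.indicator (fun x ↦ ENNReal.ofReal (1 / 4) *
              (ENNReal.ofReal (r x ^ (-(2 * t))) * ‖f x‖ₑ ^ 2)) y := by
            refine lintegral_mono fun y ↦ ?_
            refine (mul_le_mul_left (lintegral_hardyKernel_sub_le h₀ hc hε (r y)) _).trans ?_
            by_cases hy : ε < r y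
            · rw [indicator_of_mem (by exact hy), indicator_of_mem (by exact hy), mul_assoc]
              gcongr
            · rw [indicator_of_notMem (by simpa using hy), zero_mul]
              exact zero_le
        _ = ENNReal.ofReal (1 / 4) * I := by
            rw [lintegral_indicator hS, lintegral_const_mul' _ _ ENNReal.ofReal_ne_top]
    have hBD : B ≤ κ * directionalEnergy t f ν := by
      calc B = ∫⁻ h, ∫⁻ x, hardyKernel t c ε (r x) h * ‖f (x + h • ν) - f x‖ₑ ^ 2 := by
            refine lintegral_lintegral_swap (Measurable.aemeasurable ?_)
            unfold Function.uncurry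
            fun_prop
        _ ≤ ∫⁻ h, ∫⁻ x, (Ioi (0 : ℝ)).indicator (fun h ↦ κ * ENNReal.ofReal (h ^ (-1 - 2 * t))) h *
              ‖f (x + h • ν) - f x‖ₑ ^ 2 := by
            refine lintegral_mono fun h ↦ lintegral_mono fun x ↦ ?_
            exact mul_le_mul_left (hardyKernel_le h₀ hc hε) _
        _ = ∫⁻ h, (Ioi (0 : ℝ)).indicator
              (fun h ↦ κ * (ENNReal.ofReal (h ^ (-1 - 2 * t)) * increment f (h • ν))) h := by
            refine lintegral_congr fun h ↦ ?_
            rw [lintegral_const_mul _ (by fun_prop)]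
            by_cases hh : h ∈ Ioi (0 : ℝ)
            · rw [indicator_of_mem hh, indicator_of_mem hh, mul_assoc]
              rfl
            · rw [indicator_of_notMem hh, indicator_of_notMem hh, zero_mul]
        _ = κ * directionalEnergy t f ν := by
            rw [lintegral_indicator measurableSet_Ioi,
              lintegral_const_mul' _ _ ENNReal.ofReal_ne_top]
            rfl
    have hfin : I ≤ I / 2 + 2 * κ * directionalEnergy t f ν := by
      refine hIAB.trans ?_
      gcongr ?_ + ?_
      · refine (mul_le_mul_right hAI 2).trans_eq ?_
        rw [← mul_assoc, ENNReal.div_eq_inv_mul]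
        congr 1
        rw [show (2 : ℝ≥0∞) = ENNReal.ofReal 2 by simp, ← ENNReal.ofReal_mul (by norm_num),
          ← ENNReal.ofReal_inv_of_pos (by norm_num)]
        norm_num
      · rw [mul_assoc]
        gcongr
    have h₂ : I / 2 ≤ 2 * κ * directionalEnergy t f ν := by
      have h₃ : I / 2 ≠ ⊤ := ENNReal.div_ne_top hIfin (by simp)
      nth_rewrite 1 [← ENNReal.add_halves I] at hfin
      exact (ENNReal.add_le_add_iff_left h₃).mp hfin
    calc I = 2 * (I / 2) := by rw [ENNReal.mul_div_cancel (by simp) (by simp)]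
      _ ≤ 2 * (2 * κ * directionalEnergy t f ν) := by gcongr
      _ = _ := by ring
  have hU : {x | 0 < r x} = ⋃ n : ℕ, {x | 1 / ((n : ℝ) + 1) < r x} := by
    ext x
    simp only [mem_ofPred_eq, mem_iUnion]
    exact ⟨fun h ↦ exists_nat_one_div_lt h, fun ⟨n, hn⟩ ↦ lt_trans Nat.one_div_pos_of_nat hn⟩
  rw [hU, setLIntegral_iUnion_of_directed]
  · exact iSup_le fun n ↦ trunc _ Nat.one_div_pos_of_nat
  · refine Monotone.directed_le fun m n hmn x hx ↦ ?_
    have hx : 1 / ((m : ℝ) + 1) < r x := hx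
    exact (Nat.one_div_le_one_div hmn).trans_lt hx

/-! ### Multiplication by the indicator function of a Lipschitz domain -/

/-- The integral of `|f|² dist(x, ∂Ω)^{-2t}` over `S`. -/
def boundaryEnergy {d : ℕ} (t : ℝ) (Ω S : Set (E d)) (f : E d → ℂ) : ℝ≥0∞ :=
  ∫⁻ x in S, ENNReal.ofReal (Metric.infDist x Ωᶜ ^ (-(2 * t))) * ‖f x‖ₑ ^ 2

/-- Away from the boundary the weight is bounded and the `L²` norm suffices. -/
theorem boundaryEnergy_le_of_mem {d : ℕ} {t : ℝ} (h₀ : 0 < t) {Ω : Set (E d)} (hΩ : IsOpen Ω)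
    (hne : Ωᶜ.Nonempty) {p : E d} (hp : p ∈ Ω) : ∃ ρ > 0, ∃ C : ℝ≥0∞, C ≠ ⊤ ∧
      ∀ f : Lp ℂ 2 (volume : Measure (E d)),
        boundaryEnergy t Ω (Ω ∩ Metric.ball p ρ) f ≤ C * sobolevEnergy t f := by
  obtain ⟨ρ, hρ, hball⟩ := Metric.isOpen_iff.mp hΩ p hp
  refine ⟨ρ / 2, half_pos hρ, ENNReal.ofReal ((ρ / 2) ^ (-(2 * t))), ENNReal.ofReal_ne_top,
    fun f ↦ ?_⟩
  refine le_trans ?_ (mul_le_mul_right (lintegral_le_sobolevEnergy h₀.le f) _)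
  rw [← lintegral_const_mul' _ _ ENNReal.ofReal_ne_top]
  refine le_trans (setLIntegral_mono' (hΩ.inter Metric.isOpen_ball).measurableSet fun x hx ↦ ?_)
    (setLIntegral_le_lintegral _ _)
  gcongr ENNReal.ofReal ?_ * _
  refine Real.rpow_le_rpow_of_nonpos (half_pos hρ) ?_ (by linarith)
  refine (Metric.le_infDist hne).mpr fun y hy ↦ ?_
  by_contra! h
  refine hy (hball ?_)
  have h₁ := Metric.mem_ball.mp hx.2
  have h₂ := dist_triangle_left y p x
  rw [Metric.mem_ball]
  linarith

/-- The height `r` below the graph grows with unit speed along `-ν`, which suits the Hardy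
inequality in that direction. As `r` is Lipschitz, the distance to the complement is bounded below
by a multiple of `r` near `p`, so the Hardy weight dominates the distance weight up to a bounded
term. -/
theorem boundaryEnergy_le_of_mem_frontier {d : ℕ} {t : ℝ} (h₀ : 0 < t) (h₁ : t < 1 / 2)
    {Ω : Set (E d)} (hΩ : IsBoundedLipschitzDomain Ω) (hne : Ωᶜ.Nonempty) {p : E d}
    (hp : p ∈ frontier Ω) : ∃ ρ > 0, ∃ C : ℝ≥0∞, C ≠ ⊤ ∧
      ∀ f : Lp ℂ 2 (volume : Measure (E d)),
        boundaryEnergy t Ω (Ω ∩ Metric.ball p ρ) f ≤ C * sobolevEnergy t f := by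
  obtain ⟨ν, K, ζ, hν, hζ, hev⟩ := hΩ.locally_graph p hp
  obtain ⟨ρ, hρ, hball⟩ := Metric.eventually_nhds_iff.mp hev
  obtain ⟨CH, hCH, hH⟩ := hardy_inequality h₀ h₁
  obtain ⟨CD, hCD, hD⟩ := directionalEnergy_le (d := d) h₀ (by linarith)
  let r : E d → ℝ := fun x ↦ ζ (x - (inner ℝ ν x : ℝ) • ν) - inner ℝ ν x
  have hrm : Measurable r := by
    have := hζ.continuous.measurable
    fun_prop
  have hνν : inner ℝ ν ν = (1 : ℝ) := by rw [real_inner_self_eq_norm_sq, hν, one_pow]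
  have hrν : ∀ x (h : ℝ), r (x + h • -ν) = r x + h := by
    intro x h
    have e₁ : inner ℝ ν (x + h • -ν) = inner ℝ ν x - h := by
      rw [inner_add_right, inner_smul_right, inner_neg_right, hνν]
      ring
    have e₂ : x + h • -ν - (inner ℝ ν x - h) • ν = x - (inner ℝ ν x : ℝ) • ν := by
      module
    simp only [r, e₁, e₂]
    ring
  -- The projection along `ν` is estimated crudely with Lipschitz constant `2`; the `1` comes from
  -- the coordinate `⟪ν, x⟫`.
  set L : ℝ := K * 2 + 1 with hL
  have hL₀ : 0 < L := by positivity
  have hrL : ∀ x y, r x - r y ≤ L * dist x y := by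
    intro x y
    have e₁ : |inner ℝ ν x - inner ℝ ν y| ≤ dist x y := by
      rw [← inner_sub_right, dist_eq_norm]
      simpa [hν] using abs_real_inner_le_norm ν (x - y)
    have e₂ : dist (x - (inner ℝ ν x : ℝ) • ν) (y - (inner ℝ ν y : ℝ) • ν) ≤ 2 * dist x y := by
      rw [dist_eq_norm]
      calc ‖x - (inner ℝ ν x : ℝ) • ν - (y - (inner ℝ ν y : ℝ) • ν)‖
          = ‖(x - y) - (inner ℝ ν x - inner ℝ ν y) • ν‖ := by
            congr 1
            module
        _ ≤ ‖x - y‖ + ‖(inner ℝ ν x - inner ℝ ν y) • ν‖ := norm_sub_le _ _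
        _ ≤ 2 * dist x y := by
            rw [norm_smul, hν, mul_one, Real.norm_eq_abs, ← dist_eq_norm]
            linarith
    have e₃ := (le_abs_self _).trans_eq (Real.dist_eq _ _).symm |>.trans (hζ.dist_le_mul
      (x - (inner ℝ ν x : ℝ) • ν) (y - (inner ℝ ν y : ℝ) • ν))
    have e₄ : (K : ℝ) * dist (x - (inner ℝ ν x : ℝ) • ν) (y - (inner ℝ ν y : ℝ) • ν) ≤
      K * (2 * dist x y) := by gcongr
    have e₅ := neg_le_of_abs_le e₁
    simp only [r, hL]
    linarith
  have hweight : ∀ x ∈ Ω ∩ Metric.ball p (ρ / 2), 0 < r x ∧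
      Metric.infDist x Ωᶜ ^ (-(2 * t)) ≤
        (ρ / 2) ^ (-(2 * t)) + L ^ (2 * t) * r x ^ (-(2 * t)) := by
    rintro x ⟨hxΩ, hxp⟩
    have hxp := Metric.mem_ball.mp hxp
    have hrx : 0 < r x := sub_pos.mpr ((hball (by linarith)).mp hxΩ)
    refine ⟨hrx, ?_⟩
    -- Complement points within `ρ/2` of `x` lie in the chart, so `r ≤ 0` there and `r x ≤ L * dist
    -- x y`. All others are at distance at least `ρ/2`.
    have hmin : min (ρ / 2) (r x / L) ≤ Metric.infDist x Ωᶜ := by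
      refine (Metric.le_infDist hne).mpr fun y hy ↦ ?_
      rcases le_or_gt (ρ / 2) (dist x y) with h | h
      · exact (min_le_left _ _).trans h
      · refine (min_le_right _ _).trans ?_
        have hyp : dist y p < ρ := by
          have := dist_triangle_left y p x
          linarith
        have hry : r y ≤ 0 := by
          by_contra! hry
          exact hy ((hball hyp).mpr (sub_pos.mp hry))
        rw [div_le_iff₀ hL₀]
        have := hrL x y
        linarith
    have hLr : (r x / L) ^ (-(2 * t)) = L ^ (2 * t) * r x ^ (-(2 * t)) := by
      rw [Real.div_rpow hrx.le hL₀.le, Real.rpow_neg hL₀.le, div_inv_eq_mul, mul_comm]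
    rw [← hLr]
    have p₁ : 0 ≤ (ρ / 2) ^ (-(2 * t)) := by positivity
    have p₂ : 0 ≤ (r x / L) ^ (-(2 * t)) := by positivity
    refine (Real.rpow_le_rpow_of_nonpos (lt_min (half_pos hρ) (div_pos hrx hL₀)) hmin
      (by linarith)).trans ?_
    rcases min_choice (ρ / 2) (r x / L) with h | h <;> rw [h] <;> linarith
  refine ⟨ρ / 2, half_pos hρ, ENNReal.ofReal ((ρ / 2) ^ (-(2 * t))) +
    ENNReal.ofReal (L ^ (2 * t)) * (CH * CD), ?_, fun f ↦ ?_⟩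
  · exact ENNReal.add_ne_top.mpr ⟨ENNReal.ofReal_ne_top,
      ENNReal.mul_ne_top ENNReal.ofReal_ne_top (ENNReal.mul_ne_top hCH hCD)⟩
  have hf : Measurable f := (Lp.stronglyMeasurable f).measurable
  have hf₂ : ∫⁻ x, ‖f x‖ₑ ^ 2 ≠ ⊤ := by
    rw [← enorm_sq_eq_lintegral]
    simp
  have hpos : MeasurableSet {x | 0 < r x} := measurableSet_lt measurable_const hrm
  calc boundaryEnergy t Ω (Ω ∩ Metric.ball p (ρ / 2)) f
      ≤ ∫⁻ x in Ω ∩ Metric.ball p (ρ / 2), (ENNReal.ofReal ((ρ / 2) ^ (-(2 * t))) * ‖f x‖ₑ ^ 2 +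
          {x | 0 < r x}.indicator (fun x ↦ ENNReal.ofReal (L ^ (2 * t)) *
            (ENNReal.ofReal (r x ^ (-(2 * t))) * ‖f x‖ₑ ^ 2)) x) := by
        refine setLIntegral_mono' (hΩ.isOpen.inter Metric.isOpen_ball).measurableSet fun x hx ↦ ?_
        obtain ⟨hx₁, hx₂⟩ := hweight x hx
        rw [indicator_of_mem (by exact hx₁), ← mul_assoc, ← add_mul]
        gcongr
        rw [← ENNReal.ofReal_mul (by positivity),
          ← ENNReal.ofReal_add (by positivity) (by positivity)]
        exact ENNReal.ofReal_le_ofReal hx₂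
    _ ≤ ∫⁻ x, (ENNReal.ofReal ((ρ / 2) ^ (-(2 * t))) * ‖f x‖ₑ ^ 2 +
          {x | 0 < r x}.indicator (fun x ↦ ENNReal.ofReal (L ^ (2 * t)) *
            (ENNReal.ofReal (r x ^ (-(2 * t))) * ‖f x‖ₑ ^ 2)) x) := setLIntegral_le_lintegral _ _
    _ = ENNReal.ofReal ((ρ / 2) ^ (-(2 * t))) * (∫⁻ x, ‖f x‖ₑ ^ 2) +
          ENNReal.ofReal (L ^ (2 * t)) *
            ∫⁻ x in {x | 0 < r x}, ENNReal.ofReal (r x ^ (-(2 * t))) * ‖f x‖ₑ ^ 2 := by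
        rw [lintegral_add_left (by fun_prop), lintegral_indicator hpos,
          lintegral_const_mul' _ _ ENNReal.ofReal_ne_top,
          lintegral_const_mul' _ _ ENNReal.ofReal_ne_top]
    _ ≤ ENNReal.ofReal ((ρ / 2) ^ (-(2 * t))) * sobolevEnergy t f +
          ENNReal.ofReal (L ^ (2 * t)) * (CH * (CD * sobolevEnergy t f)) := by
        gcongr
        · exact lintegral_le_sobolevEnergy h₀.le f
        · refine (hH (-ν) r hrm hrν f hf hf₂).trans ?_
          gcongr
          exact hD _ (by rw [norm_neg, hν]) f
    _ = _ := by ring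

/-- The sets on which such a bound holds are stable under subsets and finite unions, so compactness
of the closure turns the local bounds into a global one. -/
theorem boundaryEnergy_le {d : ℕ} {t : ℝ} (h₀ : 0 < t) (h₁ : t < 1 / 2) {Ω : Set (E d)}
    (hΩ : IsBoundedLipschitzDomain Ω) (hne : Ωᶜ.Nonempty) : ∃ C : ℝ≥0∞, C ≠ ⊤ ∧
      ∀ f : Lp ℂ 2 (volume : Measure (E d)),
        boundaryEnergy t Ω Ω f ≤ C * sobolevEnergy t f := by
  have hcomp : IsCompact (closure Ω) := hΩ.isBounded.isCompact_closure
  have key : ∃ C : ℝ≥0∞, C ≠ ⊤ ∧ ∀ f : Lp ℂ 2 (volume : Measure (E d)),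
      boundaryEnergy t Ω (Ω ∩ closure Ω) f ≤ C * sobolevEnergy t f := by
    refine hcomp.induction_on (p := fun S ↦ ∃ C : ℝ≥0∞, C ≠ ⊤ ∧
      ∀ f : Lp ℂ 2 (volume : Measure (E d)),
        boundaryEnergy t Ω (Ω ∩ S) f ≤ C * sobolevEnergy t f) ?_ ?_ ?_ ?_
    · exact ⟨0, by simp, fun f ↦ by simp [boundaryEnergy]⟩
    · rintro S S' hSS' ⟨C, hC, h⟩
      exact ⟨C, hC, fun f ↦ (lintegral_mono_set (inter_subset_inter_right _ hSS')).trans (h f)⟩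
    · rintro S S' ⟨C, hC, h⟩ ⟨C', hC', h'⟩
      refine ⟨C + C', ENNReal.add_ne_top.mpr ⟨hC, hC'⟩, fun f ↦ ?_⟩
      rw [inter_union_distrib_left, add_mul]
      exact (lintegral_union_le _ _ _).trans (add_le_add (h f) (h' f))
    · intro p hp
      obtain ⟨ρ, hρ, h⟩ : ∃ ρ > 0, ∃ C : ℝ≥0∞, C ≠ ⊤ ∧
          ∀ f : Lp ℂ 2 (volume : Measure (E d)),
            boundaryEnergy t Ω (Ω ∩ Metric.ball p ρ) f ≤ C * sobolevEnergy t f := by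
        by_cases hpΩ : p ∈ Ω
        · exact boundaryEnergy_le_of_mem h₀ hΩ.isOpen hne hpΩ
        · refine boundaryEnergy_le_of_mem_frontier h₀ h₁ hΩ hne ?_
          rw [hΩ.isOpen.frontier_eq]
          exact ⟨hp, hpΩ⟩
      exact ⟨Metric.ball p ρ, mem_nhdsWithin_of_mem_nhds (Metric.ball_mem_nhds p hρ), h⟩
  rwa [inter_eq_left.mpr subset_closure] at key

/-! ### Increments of functions cut off outside `Ω`. -/

theorem increment_congr_ae {d : ℕ} {f g : E d → ℂ} (h : f =ᵐ[volume] g) (v : E d) :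
    increment f v = increment g v := by
  refine lintegral_congr_ae ?_
  filter_upwards [h, (measurePreserving_add_right volume v).quasiMeasurePreserving.ae h]
    with x h₁ h₂
  rw [h₁, h₂]

theorem directionalEnergy_congr_ae {d : ℕ} (t : ℝ) {f g : E d → ℂ} (h : f =ᵐ[volume] g)
    (e : E d) : directionalEnergy t f e = directionalEnergy t g e := by
  simp_rw [directionalEnergy, increment_congr_ae h]

theorem lintegral_Ici_rpow {t δ : ℝ} (h₀ : 0 < t) (hδ : 0 < δ) :
    ∫⁻ h in Ici δ, ENNReal.ofReal (h ^ (-1 - 2 * t)) =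
      ENNReal.ofReal (1 / (2 * t)) * ENNReal.ofReal (δ ^ (-(2 * t))) := by
  have hi : IntegrableOn (fun h : ℝ ↦ h ^ (-1 - 2 * t)) (Ioi δ) :=
    integrableOn_Ioi_rpow_of_lt (by linarith) hδ
  rw [setLIntegral_congr Ioi_ae_eq_Ici.symm, ← ofReal_integral_eq_lintegral_ofReal hi,
    integral_Ioi_rpow_of_lt (by linarith) hδ, ← ENNReal.ofReal_mul (by positivity)]
  · congr 1
    rw [show -1 - 2 * t + 1 = -(2 * t) by ring]
    field_simp
  · filter_upwards [ae_restrict_mem measurableSet_Ioi] with h hh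
    exact Real.rpow_nonneg (hδ.trans hh).le _

/-- The cut-off matters only if exactly one of `x`, `x + v` lies in `Ω`. That point is then within
`h` of the complement, and the increment is, up to sign, the value of `f` there; the two cases give
the factor `2`. -/
theorem increment_indicator_le {d : ℕ} {Ω : Set (E d)} (hΩ : IsOpen Ω) {f : E d → ℂ}
    (hf : Measurable f) {v : E d} {h : ℝ} (hv : ‖v‖ = h) :
    increment (Ω.indicator f) v ≤ increment f v +
      2 * ∫⁻ x in {x | x ∈ Ω ∧ Metric.infDist x Ωᶜ ≤ h}, ‖f x‖ₑ ^ 2 := by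
  set J : Set (E d) := {x | x ∈ Ω ∧ Metric.infDist x Ωᶜ ≤ h} with hJ
  have hJm : MeasurableSet J := hΩ.measurableSet.inter
    (measurableSet_le (Metric.continuous_infDist_pt _).measurable measurable_const)
  have hpt : ∀ x, ‖Ω.indicator f (x + v) - Ω.indicator f x‖ₑ ^ 2 ≤ ‖f (x + v) - f x‖ₑ ^ 2 +
      (J.indicator (fun x ↦ ‖f x‖ₑ ^ 2) x + J.indicator (fun x ↦ ‖f x‖ₑ ^ 2) (x + v)) := by
    intro x
    by_cases h₁ : x ∈ Ω <;> by_cases h₂ : x + v ∈ Ω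
    · rw [indicator_of_mem h₁, indicator_of_mem h₂]
      exact le_self_add
    · have hxJ : x ∈ J := by
        refine ⟨h₁, (Metric.infDist_le_dist_of_mem (y := x + v) h₂).trans_eq ?_⟩
        rw [dist_self_add_right, hv]
      rw [indicator_of_mem h₁, indicator_of_notMem h₂, indicator_of_mem hxJ, zero_sub, enorm_neg]
      exact le_self_add.trans le_add_self
    · have hxJ : x + v ∈ J := by
        refine ⟨h₂, (Metric.infDist_le_dist_of_mem (y := x) h₁).trans_eq ?_⟩
        rw [dist_self_add_left, hv]
      rw [indicator_of_notMem h₁, indicator_of_mem h₂, indicator_of_mem hxJ, sub_zero]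
      exact le_add_self.trans le_add_self
    · rw [indicator_of_notMem h₁, indicator_of_notMem h₂]
      simp
  refine (lintegral_mono hpt).trans_eq ?_
  have hJf : Measurable (J.indicator fun x ↦ ‖f x‖ₑ ^ 2) :=
    Measurable.indicator (by fun_prop) hJm
  rw [lintegral_add_left (by fun_prop), lintegral_add_left hJf, lintegral_add_right_eq_self
    (J.indicator fun x ↦ ‖f x‖ₑ ^ 2), lintegral_indicator hJm, two_mul]
  rfl

/-- By Tonelli, a point `x` of `Ω` is charged for all `h ≥ dist(x, Ωᶜ)`, and integrating `h^{-1-2t}`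
over these gives `dist(x, Ωᶜ)^{-2t}/(2t)`. -/
theorem directionalEnergy_indicator_le {d : ℕ} {t : ℝ} (h₀ : 0 < t) {Ω : Set (E d)}
    (hΩ : IsOpen Ω) (hne : Ωᶜ.Nonempty) {f : E d → ℂ} (hf : Measurable f) {e : E d}
    (he : ‖e‖ = 1) :
    directionalEnergy t (Ω.indicator f) e ≤
      directionalEnergy t f e + 2 * (ENNReal.ofReal (1 / (2 * t)) * boundaryEnergy t Ω Ω f) := by
  let J : Set (ℝ × E d) := {p | p.2 ∈ Ω ∧ Metric.infDist p.2 Ωᶜ ≤ p.1}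
  have hδ : Measurable fun x : E d ↦ Metric.infDist x Ωᶜ :=
    (Metric.continuous_infDist_pt _).measurable
  have hJm : MeasurableSet J := (measurable_snd hΩ.measurableSet).inter
    (measurableSet_le (hδ.comp measurable_snd) measurable_fst)
  let k : ℝ × E d → ℝ≥0∞ :=
    J.indicator fun p ↦ ENNReal.ofReal (p.1 ^ (-1 - 2 * t)) * ‖f p.2‖ₑ ^ 2
  have hk : Measurable k := Measurable.indicator (by fun_prop) hJm
  have hinc : ∀ h ∈ Ioi (0 : ℝ),
      ENNReal.ofReal (h ^ (-1 - 2 * t)) * increment (Ω.indicator f) (h • e) ≤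
        ENNReal.ofReal (h ^ (-1 - 2 * t)) * increment f (h • e) + 2 * ∫⁻ x, k (h, x) := by
    intro h hh
    have hv : ‖h • e‖ = h := by rw [norm_smul, he, mul_one, Real.norm_of_nonneg (le_of_lt hh)]
    refine (mul_le_mul_right (increment_indicator_le hΩ hf hv) _).trans_eq ?_
    have hJh : MeasurableSet {x | x ∈ Ω ∧ Metric.infDist x Ωᶜ ≤ h} :=
      hΩ.measurableSet.inter (measurableSet_le hδ measurable_const)
    rw [mul_add, mul_left_comm, ← lintegral_const_mul' _ _ ENNReal.ofReal_ne_top,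
      ← lintegral_indicator hJh]
    rfl
  have hfun : ∀ x, ∫⁻ h in Ioi (0 : ℝ), k (h, x) ≤
      Ω.indicator (fun x ↦ ENNReal.ofReal (1 / (2 * t)) *
        (ENNReal.ofReal (Metric.infDist x Ωᶜ ^ (-(2 * t))) * ‖f x‖ₑ ^ 2)) x := by
    intro x
    by_cases hx : x ∈ Ω
    · have hpos : 0 < Metric.infDist x Ωᶜ :=
        (hΩ.isClosed_compl.notMem_iff_infDist_pos hne).mp (by simpa using hx)
      rw [indicator_of_mem hx, ← mul_assoc, ← lintegral_Ici_rpow h₀ hpos,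
        ← lintegral_mul_const _ (by fun_prop), ← lintegral_indicator measurableSet_Ici]
      refine (setLIntegral_le_lintegral _ _).trans (lintegral_mono fun h ↦ ?_)
      by_cases hh : Metric.infDist x Ωᶜ ≤ h
      · rw [indicator_of_mem (by exact hh)]
        exact indicator_le_self _ _ _
      · have : (h, x) ∉ J := fun h' ↦ hh h'.2
        simp only [k]
        rw [indicator_of_notMem this]
        exact zero_le
    · have : ∀ h, k (h, x) = 0 := fun h ↦ indicator_of_notMem (fun h' ↦ hx h'.1) _
      simp [this]
  have hmono : directionalEnergy t (Ω.indicator f) e ≤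
      ∫⁻ h in Ioi (0 : ℝ), (ENNReal.ofReal (h ^ (-1 - 2 * t)) * increment f (h • e) +
        2 * ∫⁻ x, k (h, x)) := setLIntegral_mono' measurableSet_Ioi hinc
  refine hmono.trans ?_
  have hkm : Measurable fun h : ℝ ↦ 2 * ∫⁻ x, k (h, x) :=
    (Measurable.lintegral_prod_right' hk).const_mul 2
  rw [lintegral_add_right _ hkm, lintegral_const_mul' _ _ (by simp),
    lintegral_lintegral_swap (f := fun h x ↦ k (h, x)) hk.aemeasurable]
  refine add_le_add le_rfl (mul_le_mul_right ?_ 2)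
  refine (lintegral_mono hfun).trans_eq ?_
  rw [lintegral_indicator hΩ.measurableSet, lintegral_const_mul' _ _ ENNReal.ofReal_ne_top]
  rfl

theorem sobolevEnergy_zero {d : ℕ} (f : Lp ℂ 2 (volume : Measure (E d))) :
    sobolevEnergy 0 f = ∫⁻ x, ‖f x‖ₑ ^ 2 := by
  have h : ‖f‖ₑ = ‖(𝓕 f : Lp ℂ 2 (volume : Measure (E d)))‖ₑ := by
    rw [← ofReal_norm, ← ofReal_norm, Lp.norm_fourier_eq]
  rw [← enorm_sq_eq_lintegral, h, enorm_sq_eq_lintegral]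
  simp [sobolevEnergy]

/-- Multiplication by the indicator function of a bounded Lipschitz domain is bounded in `H^t` for
`0 ≤ t < 1/2`. -/
theorem sobolevEnergy_indicator_le {d : ℕ} {t : ℝ} (h₀ : 0 ≤ t) (h₁ : t < 1 / 2)
    {Ω : Set (E d)} (hΩ : IsBoundedLipschitzDomain Ω) (hne : Ωᶜ.Nonempty) :
    ∃ C : ℝ≥0∞, C ≠ ⊤ ∧ ∀ f g : Lp ℂ 2 (volume : Measure (E d)), g =ᵐ[volume] Ω.indicator f →
      sobolevEnergy t g ≤ C * sobolevEnergy t f := by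
  have hL2 : ∀ f g : Lp ℂ 2 (volume : Measure (E d)), g =ᵐ[volume] Ω.indicator f →
      ∫⁻ x, ‖g x‖ₑ ^ 2 ≤ ∫⁻ x, ‖f x‖ₑ ^ 2 := by
    intro f g hg
    refine lintegral_mono_ae ?_
    filter_upwards [hg] with x hx
    rw [hx]
    gcongr
    exact enorm_indicator_le_enorm_self _ _
  -- At `t = 0` the Gagliardo weight `h^{-1}` is not integrable at infinity, but the claim is then
  -- just monotonicity of the `L²` norm.
  rcases h₀.eq_or_lt with rfl | h₀
  · refine ⟨1, by simp, fun f g hg ↦ ?_⟩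
    rw [one_mul, sobolevEnergy_zero, sobolevEnergy_zero]
    exact hL2 f g hg
  · obtain ⟨C₁, hC₁, hE⟩ := sobolevEnergy_le (d := d) h₀ (by linarith)
    obtain ⟨C₂, hC₂, hD⟩ := directionalEnergy_le (d := d) h₀ (by linarith)
    obtain ⟨C₃, hC₃, hB⟩ := boundaryEnergy_le h₀ h₁ hΩ hne
    have hdir : ∀ f g : Lp ℂ 2 (volume : Measure (E d)), g =ᵐ[volume] Ω.indicator f →
        ∀ i : Fin d, directionalEnergy t g (EuclideanSpace.single i (1 : ℝ)) ≤
          (C₂ + 2 * (ENNReal.ofReal (1 / (2 * t)) * C₃)) * sobolevEnergy t f := by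
      intro f g hg i
      have he : ‖(EuclideanSpace.single i (1 : ℝ) : E d)‖ = 1 := by simp
      rw [directionalEnergy_congr_ae t hg, add_mul]
      refine (directionalEnergy_indicator_le h₀ hΩ.isOpen hne
        (Lp.stronglyMeasurable f).measurable he).trans ?_
      refine add_le_add (hD _ he f) ?_
      rw [mul_assoc, mul_assoc]
      gcongr
      exact hB f
    refine ⟨1 + C₁ * ∑ _i : Fin d, (C₂ + 2 * (ENNReal.ofReal (1 / (2 * t)) * C₃)), ?_,
      fun f g hg ↦ ?_⟩
    · refine ENNReal.add_ne_top.mpr ⟨by simp, ENNReal.mul_ne_top hC₁ ?_⟩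
      refine (ENNReal.sum_lt_top.mpr fun _ _ ↦ ?_).ne
      refine (ENNReal.add_ne_top.mpr ⟨hC₂, ENNReal.mul_ne_top (by simp) ?_⟩).lt_top
      exact ENNReal.mul_ne_top ENNReal.ofReal_ne_top hC₃
    · refine (hE g).trans ?_
      rw [add_mul, one_mul, mul_assoc, Finset.sum_mul]
      gcongr with i
      · exact (hL2 f g hg).trans (lintegral_le_sobolevEnergy h₀.le f)
      · exact hdir f g hg i

/-! ### Extension by zero -/

/-- The bridge from the distributional definition of the norm to weighted integrals. It is stated
for the order `-t ≤ 0` because the symbol is then bounded, and multiplication by it stays in `L²`.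
-/
theorem besselPotential_neg_eq_iff {d : ℕ} {t : ℝ} (ht : 0 ≤ t)
    (b f : Lp ℂ 2 (volume : Measure (E d))) :
    besselPotential (E d) ℂ (-t) (b : 𝓢'(E d, ℂ)) = f ↔
      (𝓕 f : Lp ℂ 2 (volume : Measure (E d))) =ᵐ[volume] fun ξ ↦
        (((1 + ‖ξ‖ ^ 2) ^ (-t / 2) : ℝ) : ℂ) * (𝓕 b : Lp ℂ 2 (volume : Measure (E d))) ξ := by
  set m : E d → ℂ := fun ξ ↦ (((1 + ‖ξ‖ ^ 2) ^ (-t / 2) : ℝ) : ℂ) with hm_def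
  have hm : m.HasTemperateGrowth := by fun_prop
  have hm' : MemLp m ⊤ (volume : Measure (E d)) := by
    refine memLp_top_of_bound hm.1.continuous.aestronglyMeasurable 1
      (Eventually.of_forall fun ξ ↦ ?_)
    rw [hm_def, Complex.norm_real, Real.norm_of_nonneg (by positivity)]
    exact Real.rpow_le_one_of_one_le_of_nonpos (by nlinarith [sq_nonneg ‖ξ‖]) (by linarith)
  set p : Lp ℂ 2 (volume : Measure (E d)) := hm'.toLp m • (𝓕 b : Lp ℂ 2 (volume : Measure (E d)))
    with hp_def
  have hp : (p : 𝓢'(E d, ℂ)) = 𝓕 (besselPotential (E d) ℂ (-t) (b : 𝓢'(E d, ℂ))) := by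
    rw [hp_def, Lp.toTemperedDistribution_smul_eq (r := 2) hm hm',
      ← Lp.fourier_toTemperedDistribution_eq,
      fourier_besselPotential_eq_smulLeftCLM_fourier_apply]
  have hpae : p =ᵐ[volume] fun ξ ↦ m ξ * (𝓕 b : Lp ℂ 2 (volume : Measure (E d))) ξ := by
    filter_upwards [Lp.coeFn_lpSMul (r := 2) (hm'.toLp m) (𝓕 b : Lp ℂ 2 (volume : Measure (E d))),
      hm'.coeFn_toLp] with ξ h₁ h₂
    rw [hp_def, h₁, Pi.smul_apply', h₂, smul_eq_mul]
  have h₁ : besselPotential (E d) ℂ (-t) (b : 𝓢'(E d, ℂ)) = f ↔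
      (𝓕 f : Lp ℂ 2 (volume : Measure (E d))) = p := by
    constructor
    · intro h
      apply SobolevSpace.lp_toDistribution_injective
      simp only [Lp.toTemperedDistributionCLM_apply]
      rw [hp, h, Lp.fourier_toTemperedDistribution_eq]
    · intro h
      have h₂ : 𝓕 (besselPotential (E d) ℂ (-t) (b : 𝓢'(E d, ℂ))) = 𝓕 (f : 𝓢'(E d, ℂ)) := by
        rw [← hp, Lp.fourier_toTemperedDistribution_eq, h]
      have h₃ := congrArg (fun v : 𝓢'(E d, ℂ) ↦ (𝓕⁻ v : 𝓢'(E d, ℂ))) h₂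
      simpa only [FourierTransform.fourierInv_fourier_eq] using h₃
  rw [h₁]
  constructor
  · intro h
    rw [h]
    exact hpae
  · intro h
    exact Lp.ext (h.trans hpae.symm)

theorem ofReal_rpow_mul_enorm_sq {d : ℕ} (t : ℝ) (ξ : E d) (z : ℂ) :
    ENNReal.ofReal ((1 + ‖ξ‖ ^ 2) ^ t) *
      ‖(((1 + ‖ξ‖ ^ 2) ^ (-t / 2) : ℝ) : ℂ) * z‖ₑ ^ 2 = ‖z‖ₑ ^ 2 := by
  have hX : 0 < 1 + ‖ξ‖ ^ 2 := by positivity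
  rw [enorm_mul, mul_pow, ← mul_assoc, ← ofReal_norm, Complex.norm_real,
    Real.norm_of_nonneg (by positivity), ← ENNReal.ofReal_pow (by positivity),
    ← ENNReal.ofReal_mul (by positivity), ← Real.rpow_mul_natCast hX.le, ← Real.rpow_add hX]
  simp

theorem sobolevEnergy_eq_enorm_sq {d : ℕ} {t : ℝ} (ht : 0 ≤ t) {u : SobolevSpace d t}
    {f : Lp ℂ 2 (volume : Measure (E d))} (h : u.toDistribution = Lp.toTemperedDistribution f) :
    sobolevEnergy t f = ENNReal.ofReal ‖u‖ ^ 2 := by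
  have h₁ := (besselPotential_neg_eq_iff ht u.bessel f).mp (by
    rw [← h]
    exact (SobolevSpace.toDistribution_eq u).symm)
  have h₂ : ‖u‖ = ‖(𝓕 u.bessel : Lp ℂ 2 (volume : Measure (E d)))‖ := by
    rw [Lp.norm_fourier_eq]
    rfl
  rw [h₂, ofReal_norm, enorm_sq_eq_lintegral]
  refine lintegral_congr_ae ?_
  filter_upwards [h₁] with ξ hξ
  rw [hξ, ofReal_rpow_mul_enorm_sq]

theorem memSobolev_of_sobolevEnergy_ne_top {d : ℕ} {t : ℝ} (ht : 0 ≤ t)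
    {f : Lp ℂ 2 (volume : Measure (E d))} (h : sobolevEnergy t f ≠ ⊤) :
    MemSobolev t 2 (f : 𝓢'(E d, ℂ)) := by
  set F : Lp ℂ 2 (volume : Measure (E d)) := 𝓕 f with hF_def
  have hF : Measurable F := (Lp.stronglyMeasurable _).measurable
  let G : E d → ℂ := fun ξ ↦ (((1 + ‖ξ‖ ^ 2) ^ (t / 2) : ℝ) : ℂ) * F ξ
  have hG : Measurable G := by fun_prop
  have hFG : ∀ ξ, F ξ = (((1 + ‖ξ‖ ^ 2) ^ (-t / 2) : ℝ) : ℂ) * G ξ := by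
    intro ξ
    simp only [G]
    rw [← mul_assoc, ← Complex.ofReal_mul, ← Real.rpow_add (by positivity), neg_div,
      neg_add_cancel, Real.rpow_zero, Complex.ofReal_one, one_mul]
  have hG₂ : MemLp G 2 (volume : Measure (E d)) := by
    refine ⟨hG.aestronglyMeasurable, ?_⟩
    rw [eLpNorm_lt_top_iff_lintegral_rpow_enorm_lt_top (by norm_num) (by norm_num)]
    refine lt_of_le_of_lt (le_of_eq ?_) h.lt_top
    refine lintegral_congr fun ξ ↦ ?_
    rw [← hF_def, hFG ξ, ofReal_rpow_mul_enorm_sq]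
    simp
  refine ⟨𝓕⁻ (hG₂.toLp G), ?_⟩
  rw [← besselPotential_neg_apply_eq_iff, besselPotential_neg_eq_iff ht,
    FourierTransform.fourier_fourierInv_eq]
  filter_upwards [hG₂.coeFn_toLp] with ξ hξ
  rw [hξ, ← hFG ξ]

theorem SobolevSpace.exists_lp {d : ℕ} {t : ℝ} (ht : 0 ≤ t) (u : SobolevSpace d t) :
    ∃ f : Lp ℂ 2 (volume : Measure (E d)), u.toDistribution = Lp.toTemperedDistribution f := by
  obtain ⟨f, hf, -⟩ := exists_lp_fourierMultiplier (d := d)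
    (m := fun ξ ↦ (((1 + ‖ξ‖ ^ 2) ^ (-t / 2) : ℝ) : ℂ)) (by fun_prop) zero_le_one
    (fun ξ ↦ by
      rw [Complex.norm_real, Real.norm_of_nonneg (by positivity)]
      exact Real.rpow_le_one_of_one_le_of_nonpos (by nlinarith [sq_nonneg ‖ξ‖]) (by linarith))
    u.bessel
  exact ⟨f, (SobolevSpace.toDistribution_eq u).trans hf⟩

/-- `w` is the extension by zero of the restriction of the function `u` to `Ω`. -/
def IsZeroExtension {d : ℕ} {t : ℝ} {Ω : Set (E d)} (u : SobolevSpace d t)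
    (w : SobolevSupported d t Ω) : Prop :=
  ∃ f g : Lp ℂ 2 (volume : Measure (E d)), u.toDistribution = Lp.toTemperedDistribution f ∧
    w.1.toDistribution = Lp.toTemperedDistribution g ∧ g =ᵐ[volume] Ω.indicator f

namespace IsZeroExtension

variable {d : ℕ} {t : ℝ} {Ω : Set (E d)} {u u' : SobolevSpace d t} {w w' : SobolevSupported d t Ω}

theorem add (h : IsZeroExtension u w) (h' : IsZeroExtension u' w') :
    IsZeroExtension (u + u') (w + w') := by
  obtain ⟨f, g, hf, hg, hfg⟩ := h
  obtain ⟨f', g', hf', hg', hfg'⟩ := h'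
  refine ⟨f + f', g + g', ?_, ?_, ?_⟩
  · rw [map_add, hf, hf']
    exact (map_add (Lp.toTemperedDistributionCLM ℂ volume 2) f f').symm
  · rw [Submodule.coe_add, map_add, hg, hg']
    exact (map_add (Lp.toTemperedDistributionCLM ℂ volume 2) g g').symm
  · filter_upwards [hfg, hfg', Lp.coeFn_add f f', Lp.coeFn_add g g'] with x h₁ h₂ h₃ h₄
    by_cases hx : x ∈ Ω <;> simp_all

theorem smul (c : ℂ) (h : IsZeroExtension u w) : IsZeroExtension (c • u) (c • w) := by
  obtain ⟨f, g, hf, hg, hfg⟩ := h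
  refine ⟨c • f, c • g, ?_, ?_, ?_⟩
  · rw [map_smul, hf]
    exact (map_smul (Lp.toTemperedDistributionCLM ℂ volume 2) c f).symm
  · rw [Submodule.coe_smul, map_smul, hg]
    exact (map_smul (Lp.toTemperedDistributionCLM ℂ volume 2) c g).symm
  · filter_upwards [hfg, Lp.coeFn_smul c f, Lp.coeFn_smul c g] with x h₁ h₂ h₃
    by_cases hx : x ∈ Ω <;> simp_all

theorem ae_eq_indicator (h : IsZeroExtension u w) {f : Lp ℂ 2 (volume : Measure (E d))}
    (hf : u.toDistribution = Lp.toTemperedDistribution f) :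
    ∃ g : Lp ℂ 2 (volume : Measure (E d)), w.1.toDistribution = Lp.toTemperedDistribution g ∧
      g =ᵐ[volume] Ω.indicator f := by
  obtain ⟨f', g, hf', hg, hfg⟩ := h
  obtain rfl : f' = f := SobolevSpace.lp_toDistribution_injective (hf'.symm.trans hf)
  exact ⟨g, hg, hfg⟩

theorem unique (h : IsZeroExtension u w) (h' : IsZeroExtension u w') : w = w' := by
  obtain ⟨f, g, hf, hg, hfg⟩ := h
  obtain ⟨g', hg', hfg'⟩ := h'.ae_eq_indicator hf
  obtain rfl : g = g' := Lp.ext (hfg.trans hfg'.symm)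
  exact Subtype.ext (SobolevSpace.toDistribution_injective (hg.trans hg'.symm))

/-- This lets extension by zero descend to the quotient `H^t(Ω)`. -/
theorem eq_zero_of_mem_vanishingOn (hΩ : IsOpen Ω) (h : IsZeroExtension u w)
    (hu : u ∈ vanishingOn d t Ω) : w = 0 := by
  obtain ⟨f, g, hf, hg, hfg⟩ := h
  have hf₀ := ae_eq_zero_of_isVanishingOn hΩ f (by rw [← hf]; exact hu)
  have hg₀ : g = 0 := by
    refine Lp.ext ?_
    filter_upwards [hfg, hf₀, Lp.coeFn_zero ℂ 2 (volume : Measure (E d))] with x h₁ h₂ h₃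
    rw [h₁, h₃]
    by_cases hx : x ∈ Ω
    · rw [indicator_of_mem hx, h₂ hx]
      rfl
    · rw [indicator_of_notMem hx]
      rfl
  refine Subtype.ext (SobolevSpace.toDistribution_injective ?_)
  rw [hg, hg₀, Submodule.coe_zero, map_zero]
  exact map_zero (Lp.toTemperedDistributionCLM ℂ volume 2)

end IsZeroExtension

theorem exists_isZeroExtension {d : ℕ} {t : ℝ} (h₀ : 0 ≤ t) (h₁ : t < 1 / 2) {Ω : Set (E d)}
    (hΩ : IsBoundedLipschitzDomain Ω) (hne : Ωᶜ.Nonempty) :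
    ∃ C : ℝ, ∀ u : SobolevSpace d t, ∃ w : SobolevSupported d t Ω,
      IsZeroExtension u w ∧ ‖w‖ ≤ C * ‖u‖ := by
  obtain ⟨C, hC, h⟩ := sobolevEnergy_indicator_le h₀ h₁ hΩ hne
  -- The energies are squared norms.
  refine ⟨√C.toReal, fun u ↦ ?_⟩
  obtain ⟨f, hf⟩ := u.exists_lp h₀
  have hmem : MemLp (Ω.indicator f) 2 (volume : Measure (E d)) :=
    (Lp.memLp f).indicator hΩ.isOpen.measurableSet
  set g := hmem.toLp (Ω.indicator f)
  have hg : g =ᵐ[volume] Ω.indicator f := hmem.coeFn_toLp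
  have hen := h f g hg
  rw [sobolevEnergy_eq_enorm_sq h₀ hf] at hen
  have hfin : sobolevEnergy t g ≠ ⊤ := ne_top_of_le_ne_top
    (ENNReal.mul_ne_top hC (ENNReal.pow_ne_top ENNReal.ofReal_ne_top)) hen
  let w₀ : SobolevSpace d t :=
    (⟨_, memSobolev_of_sobolevEnergy_ne_top h₀ hfin⟩ : sobolevSubmodule d t)
  have hw₀ : w₀.toDistribution = Lp.toTemperedDistribution g := rfl
  refine ⟨⟨w₀, fun ψ hψ ↦ ?_⟩, ⟨f, g, hf, hw₀, hg⟩, ?_⟩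
  · rw [hw₀, Lp.toTemperedDistribution_apply]
    refine integral_eq_zero_of_ae ?_
    filter_upwards [hg] with x hx
    by_cases hxΩ : x ∈ Ω
    · rw [image_eq_zero_of_notMem_tsupport fun h ↦ hψ h (subset_closure hxΩ), zero_smul]
      rfl
    · rw [hx, indicator_of_notMem hxΩ, smul_zero]
      rfl
  · rw [sobolevEnergy_eq_enorm_sq h₀ hw₀, ← ENNReal.ofReal_pow (norm_nonneg _),
      ← ENNReal.ofReal_pow (norm_nonneg _), ← ENNReal.ofReal_toReal hC,
      ← ENNReal.ofReal_mul ENNReal.toReal_nonneg,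
      ENNReal.ofReal_le_ofReal_iff (by positivity)] at hen
    change ‖w₀‖ ≤ _
    refine le_of_sq_le_sq ?_ (by positivity)
    rwa [mul_pow, Real.sq_sqrt ENNReal.toReal_nonneg]

/-- For `0 ≤ t < 1/2`, extension by zero is a continuous map from `H^t(Ω)` to `H̃^t(Ω)`. -/
theorem exists_zeroExtension {d : ℕ} {t : ℝ} (h₀ : 0 ≤ t) (h₁ : t < 1 / 2) {Ω : Set (E d)}
    (hΩ : IsBoundedLipschitzDomain Ω) (hne : Ωᶜ.Nonempty) :
    ∃ Z : SobolevOn d t Ω →L[ℂ] SobolevSupported d t Ω,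
      ∀ u : SobolevSpace d t, IsZeroExtension u (Z (restrict Ω u)) := by
  obtain ⟨C, hC⟩ := exists_isZeroExtension h₀ h₁ hΩ hne
  choose z hz hzC using hC
  -- The chosen extension is linear because zero extensions are unique.
  let Z₀ : SobolevSpace d t →ₗ[ℂ] SobolevSupported d t Ω :=
    { toFun := z
      map_add' := fun u u' ↦ (hz (u + u')).unique ((hz u).add (hz u'))
      map_smul' := fun c u ↦ (hz (c • u)).unique ((hz u).smul c) }
  refine ⟨(vanishingOn d t Ω).liftQL (Z₀.mkContinuous C hzC) fun u hu ↦ ?_, fun u ↦ ?_⟩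
  · exact (hz u).eq_zero_of_mem_vanishingOn hΩ.isOpen hu
  · exact hz u

end RieszPotential

end

/-! ### The two mapping properties. -/

theorem mainTheorem4 (d : ℕ) (α s : ℝ)
    (hd : (d = 3 ∧ α ∈ Set.Ioo (0 : ℝ) 1) ∨ (d = 2 ∧ α ∈ Set.Ioo (1 / 2 : ℝ) (3 / 4)))
    (Ω : Set (RieszPotential.E d)) (hΩ : RieszPotential.IsBoundedLipschitzDomain Ω) :
    (∃ T : RieszPotential.SobolevSupported d (s - 2 * α) Ω →L[ℂ] RieszPotential.SobolevOn d s Ω,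
      ∀ u : RieszPotential.SobolevSupported d (s - 2 * α) Ω,
        RieszPotential.IsRieszPotential α u.1 (T u) ∧
        ∀ f : Lp ℂ 2 (volume : Measure (RieszPotential.E d)),
          u.1.toDistribution = Lp.toTemperedDistribution f →
            RieszPotential.IsGivenBy (T u) (RieszPotential.rieszPotential α f)) ∧
    (0 ≤ s - 2 * α → s - 2 * α < 1 / 2 →
      ∃ T : RieszPotential.SobolevOn d (s - 2 * α) Ω →L[ℂ] RieszPotential.SobolevOn d s Ω,
        ∀ (u : RieszPotential.SobolevSpace d (s - 2 * α))
          (f : Lp ℂ 2 (volume : Measure (RieszPotential.E d))),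
          u.toDistribution = Lp.toTemperedDistribution f →
            RieszPotential.IsGivenBy (T (RieszPotential.restrict Ω u))
              (RieszPotential.rieszPotential α (Ω.indicator f))) := by
  obtain ⟨hd₁, h₀, h₁, h₂⟩ : 1 ≤ d ∧ 0 < α ∧ α < 1 ∧ 2 * α < d := by
    rcases hd with ⟨rfl, h⟩ | ⟨rfl, h⟩ <;> obtain ⟨h, h'⟩ := h <;>
      refine ⟨by norm_num, by linarith, by linarith, ?_⟩ <;> push_cast <;> linarith
  obtain ⟨T, hT⟩ :=
    RieszPotential.exists_rieszPotential_supported hd₁ h₀ h₁ h₂ s hΩ.isBounded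
  refine ⟨⟨T, hT⟩, fun ht₀ ht₁ ↦ ?_⟩
  have : Nonempty (Fin d) := ⟨⟨0, hd₁⟩⟩
  -- The distance `Metric.infDist` to an empty complement would be `0` by default. A bounded set is
  -- not the whole space, since `d ≥ 1`.
  have hne : Ωᶜ.Nonempty := by
    rw [nonempty_compl]
    rintro rfl
    exact NormedSpace.unbounded_univ ℝ (RieszPotential.E d) hΩ.isBounded
  obtain ⟨Z, hZ⟩ := RieszPotential.exists_zeroExtension ht₀ ht₁ hΩ hne
  refine ⟨T ∘L Z, fun u f hf ↦ ?_⟩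
  obtain ⟨g, hg, hfg⟩ := (hZ u).ae_eq_indicator hf
  -- The potential is an integral, so altering the density on a null set leaves it unchanged at
  -- every point.
  have hR : RieszPotential.rieszPotential α (Ω.indicator f) =
      RieszPotential.rieszPotential α g := by
    ext x
    refine integral_congr_ae ?_
    filter_upwards [hfg] with y hy
    rw [hy]
  rw [hR]
  exact (hT _).2 g hg
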